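/- Work in the first-order language of arithmetic with constants $0,1$, binary operations $+,\times$ and a binary relation $\le$; write $x<y$ for $x\le y\wedge x\ne y$, $x\mid y$ for $\exists z\,(z\cdot x=y)$, $2:=1+1$, $3:=2+1$, and let $$\mathsf{pow}_2(x):\Leftrightarrow\forall y\,(y\mid x\to(y=1\vee 2\mid y))\quad\text{(Smullyan)},\qquad \mathsf{pow}_2^{\mathsf{tar}}(x):\Leftrightarrow\forall y\,\forall z\;x\ne(2y+3)\cdot z\quad\text{(Tarski)}.$$ Let $\mathsf{PA}^-$ be the theory of the non-negative parts of discretely ordered commutative rings, axiomatised by (the universal closures of): $x+0=x$; $x+y=y+x$; $(x+y)+z=x+(y+z)$; $x\cdot1=x$; $xy=yx$; $(xy)z=x(yz)$; $x(y+z)=xy+xz$; $x\le y\vee y\le x$; $(x\le y\wedge y\le z)\to x\le z$; $x+1\not\le x$; $y\le x\to(y=x\vee y+1\le x)$; $y\le x\to y+z\le x+z$; $y\le x\to yz\le xz$; $y\le x\to\exists z\,(x=y+z)$. Let $\mathsf{IOpen}$ be $\mathsf{PA}^-$ together with the induction axioms $(\varphi(0)\wedge\forall x(\varphi(x)\to\varphi(x+1)))\to\forall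 x\,\varphi(x)$ for all quantifier-free formulas $\varphi$, with parameters allowed. Let $\mathsf{PA}^-_{\mathsf{smu}}$ be $\mathsf{PA}^-$ together with the Powers Existence Principle $$\forall x\,\exists y\,(\mathsf{pow}_2(y)\wedge y\le x+1\wedge x+1<2y)$$ and the Powers Division Principle $\forall x\,\forall y\,((\mathsf{pow}_2(x)\wedge\mathsf{pow}_2(y)\wedge x\le y)\to x\mid y)$. Let $\mathbb S$ (Shepherdson's model) consist of all formal expressions $P=a_nX^{n/q}+a_{n-1}X^{(n-1)/q}+\dots+a_1X^{1/q}+a_0$, where $q>0$ is an integer, the $a_i$ are real algebraic numbers, $a_0\in\mathbb Z$, and $P$ is zero or has positive leading coefficient, with the usual addition and multiplication, ordered by: $P\le Q$ iff $Q-P$ is zero or has positive leading coefficient. Call an element of $\mathbb S$ nonstandard if it is not a natural number. Then: 1. $\mathbb S$ is a model of $\mathsf{IOpen}$. 2. In $\mathbb S$ the formulas $\mathsf{pow}_2$ and $\mathsf{pow}_2^{\mathsf{tar}}$ define the same set, and no nonstandard element of $\mathbb S$ satisfies either of them. 3. $\mathsf{IOpen}$ does not prove the Powers Existence Principle. 4.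 $\mathsf{PA}^-_{\mathsf{smu}}$ is not contained in $\mathsf{IOpen}$: some theorem of $\mathsf{PA}^-_{\mathsf{smu}}$ is not a theorem of $\mathsf{IOpen}$. -/

import Mathlib

open FirstOrder FirstOrder.Language

/-! ### The language of arithmetic: `0`, `1`, `+`, `×`, `≤` -/

/-- Function symbols of the language of arithmetic. -/
inductive ArithFunc : ℕ → Type
  | zero : ArithFunc 0
  | one : ArithFunc 0
  | add : ArithFunc 2
  | mul : ArithFunc 2

/-- Relation symbols of the language of arithmetic. -/
inductive ArithRel : ℕ → Type
  | le : ArithRel 2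

/-- The first-order language with constants `0`, `1`, binary operations `+`, `×` and a binary
relation `≤`. -/
def arith : FirstOrder.Language.{0, 0} where
  Functions := ArithFunc
  Relations := ArithRel

namespace Arith

instance {α : Type} : Zero (arith.Term α) :=
  ⟨Constants.term (L := arith) ArithFunc.zero⟩

instance {α : Type} : One (arith.Term α) :=
  ⟨Constants.term (L := arith) ArithFunc.one⟩

instance {α : Type} : Add (arith.Term α) :=
  ⟨Functions.apply₂ (L := arith) ArithFunc.add⟩

instance {α : Type} : Mul (arith.Term α) :=
  ⟨Functions.apply₂ (L := arith) ArithFunc.mul⟩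

/-- Formulas of arithmetic without free variables other than the de Bruijn levels
`&0, …, &(n-1)`. -/
abbrev Fml (n : ℕ) := arith.BoundedFormula Empty n

/-- Terms in the variables `&0, …, &(n-1)`. -/
abbrev Tm (n : ℕ) := arith.Term (Empty ⊕ Fin n)

/-- A term in `n` variables regarded as a term in `n + 1` variables. -/
def up {n : ℕ} (t : Tm n) : Tm (n + 1) := t.relabel (Sum.map id Fin.castSucc)

/-- The newest variable, i.e. the one bound by the innermost quantifier. -/
def new {n : ℕ} : Tm (n + 1) := Term.var (Sum.inr (Fin.last n))

/-- The numeral `2 = 1 + 1`. -/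
def two {n : ℕ} : Tm n := 1 + 1

/-- The numeral `3 = 2 + 1`. -/
def three {n : ℕ} : Tm n := two + 1

/-- `s ≤ t` -/
def le {n : ℕ} (s t : Tm n) : Fml n := Relations.boundedFormula₂ (L := arith) ArithRel.le s t

/-- `s < t`, i.e. `s ≤ t ∧ s ≠ t` -/
def lt {n : ℕ} (s t : Tm n) : Fml n := le s t ⊓ ∼(s =' t)

/-- `s ∣ t`, i.e. `∃ z, z · s = t` -/
def dvd {n : ℕ} (s t : Tm n) : Fml n := ∃' ((new * up s) =' up t)

/-- Smullyan's powers of two: `∀ y, y ∣ t → y = 1 ∨ 2 ∣ y` -/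
def pow2 {n : ℕ} (t : Tm n) : Fml n := ∀' (dvd new (up t) ⟹ ((new =' 1) ⊔ dvd two new))

/-- Tarski's powers of two: `∀ y z, t ≠ (2 · y + 3) · z` -/
def pow2Tar {n : ℕ} (t : Tm n) : Fml n :=
  ∀' ∀' ∼(up (up t) =' ((two * up new + three) * new))

/-! ### The theories -/

/-- The axioms of the theory of discretely ordered commutative semirings with least element. -/
def PAjer : arith.Theory :=
  { ∀' (((&0 : Tm 1) + 0) =' &0),
    ∀' ∀' (((&0 : Tm 2) + &1) =' (&1 + &0)),
    ∀' ∀' ∀' ((((&0 : Tm 3) + &1) + &2) =' (&0 + (&1 + &2))),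
    ∀' (((&0 : Tm 1) * 1) =' &0),
    ∀' ∀' (((&0 : Tm 2) * &1) =' (&1 * &0)),
    ∀' ∀' ∀' ((((&0 : Tm 3) * &1) * &2) =' (&0 * (&1 * &2))),
    ∀' ∀' ∀' (((&0 : Tm 3) * (&1 + &2)) =' (&0 * &1 + &0 * &2)),
    ∀' ∀' (le (&0 : Tm 2) &1 ⊔ le &1 &0),
    ∀' ∀' ∀' ((le (&0 : Tm 3) &1 ⊓ le &1 &2) ⟹ le &0 &2),
    ∀' ∼(le ((&0 : Tm 1) + 1) &0),
    ∀' ∀' (le (&1 : Tm 2) &0 ⟹ ((&1 =' &0) ⊔ le (&1 + 1) &0)),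
    ∀' ∀' ∀' (le (&1 : Tm 3) &0 ⟹ le (&1 + &2) (&0 + &2)),
    ∀' ∀' ∀' (le (&1 : Tm 3) &0 ⟹ le (&1 * &2) (&0 * &2)) }

/-- The Subtraction Principle: `∀ x y, y ≤ x → ∃ z, x = y + z` -/
def subtraction : arith.Sentence :=
  ∀' ∀' (le (&1 : Tm 2) &0 ⟹ ∃' ((&0 : Tm 3) =' (&1 + &2)))

/-- `PA⁻`, the theory of the non-negative parts of discretely ordered commutative rings. -/
def PAminus : arith.Theory := PAjer ∪ {subtraction}

/-- The Powers Existence Principle: `∀ x, ∃ y, pow₂(y) ∧ y ≤ x + 1 ∧ x + 1 < 2 · y` -/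
def powersExistence : arith.Sentence :=
  ∀' ∃' (pow2 (&1 : Tm 2) ⊓ (le &1 (&0 + 1) ⊓ lt (&0 + 1) (two * &1)))

/-- The Powers Division Principle: `∀ x y, pow₂(x) ∧ pow₂(y) ∧ x ≤ y → x ∣ y` -/
def powersDivision : arith.Sentence :=
  ∀' ∀' ((pow2 (&0 : Tm 2) ⊓ (pow2 &1 ⊓ le &0 &1)) ⟹ dvd &0 &1)

/-- `PA⁻_smu`: `PA⁻` plus the Powers Existence and the Powers Division Principles. -/
def PAsmu : arith.Theory := PAminus ∪ {powersExistence, powersDivision}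

/-- The induction axiom for the formula `φ`, whose free variables are the parameters
`Sum.inl 0, …, Sum.inl (k-1)` and the induction variable `Sum.inr ()`: the universal closure of
`φ(0) ∧ (∀ x, φ(x) → φ(x + 1)) → ∀ x, φ(x)`. -/
noncomputable def induction {k : ℕ} (φ : arith.Formula (Fin k ⊕ Unit)) : arith.Sentence :=
  let φ0 : arith.Formula (Fin k) := φ.subst (Sum.elim Term.var (fun _ => 0))
  let φsucc : arith.Formula (Fin k ⊕ Unit) :=
    φ.subst (Sum.elim (fun i => Term.var (Sum.inl i)) (fun _ => Term.var (Sum.inr ()) + 1))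
  let ind : arith.Formula (Fin k) :=
    (φ0 ⊓ Formula.iAlls Unit (φ ⟹ φsucc)) ⟹ Formula.iAlls Unit φ
  Formula.iAlls (Fin k) (Formula.relabel (Sum.inr : Fin k → Empty ⊕ Fin k) ind)

/-- `IOpen`: `PA⁻` plus induction for all open (quantifier-free) formulas, with parameters. -/
def IOpen : arith.Theory :=
  PAminus ∪ {σ | ∃ (k : ℕ) (φ : arith.Formula (Fin k ⊕ Unit)), φ.IsQF ∧ σ = induction φ}

/-- `T` is a subtheory of `T'`: every theorem of `T` is a theorem of `T'`. -/
def IsSubtheory (T T' : arith.Theory) : Prop := ∀ σ : arith.Sentence, T ⊨ᵇ σ → T' ⊨ᵇ σ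

/-- `a` satisfies Smullyan's definition of a power of two in `M`. -/
def IsPow2 {M : Type} [arith.Structure M] (a : M) : Prop :=
  (pow2 (&0 : Tm 1)).Realize default ![a]

/-- `a` satisfies Tarski's definition of a power of two in `M`. -/
def IsPow2Tar {M : Type} [arith.Structure M] (a : M) : Prop :=
  (pow2Tar (&0 : Tm 1)).Realize default ![a]

/-! ### Shepherdson's model -/

/-- The field of real algebraic numbers. -/
abbrev RealAlg : Type := algebraicClosure ℚ ℝ

/-- Formal finite sums `∑ aᵣ X ^ r` with exponents `r` in the non-negative rationals and real
algebraic coefficients, i.e. polynomials over the real algebraic numbers in some `X ^ (1 / q)`,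
`q > 0`. -/
abbrev FracPoly : Type := AddMonoidAlgebra RealAlg ℚ≥0

/-- `P` is zero or its leading coefficient is positive. -/
def Nonneg (P : FracPoly) : Prop :=
  P = 0 ∨ ∃ r : ℚ≥0, 0 < (P.coeff r : ℝ) ∧ ∀ s, r < s → P.coeff s = 0

theorem Nonneg.add {P Q : FracPoly} (hP : Nonneg P) (hQ : Nonneg Q) : Nonneg (P + Q) := by
  rcases hP with rfl | ⟨r, hr, hr'⟩
  · simpa using hQ
  rcases hQ with rfl | ⟨s, hs, hs'⟩
  · exact Or.inr ⟨r, by simpa using hr, by simpa using hr'⟩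
  right
  rcases lt_trichotomy r s with h | rfl | h
  · refine ⟨s, ?_, fun t ht => ?_⟩
    · simpa [hr' s h] using hs
    · simp [hr' t (h.trans ht), hs' t ht]
  · refine ⟨r, ?_, fun t ht => ?_⟩
    · simpa using add_pos hr hs
    · simp [hr' t ht, hs' t ht]
  · refine ⟨r, ?_, fun t ht => ?_⟩
    · simpa [hs' r h] using hr
    · simp [hr' t ht, hs' t (h.trans ht)]

theorem Nonneg.mul {P Q : FracPoly} (hP : Nonneg P) (hQ : Nonneg Q) : Nonneg (P * Q) := by
  classical
  rcases hP with rfl | ⟨r, hr, hr'⟩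
  · exact Or.inl (zero_mul _)
  rcases hQ with rfl | ⟨s, hs, hs'⟩
  · exact Or.inl (mul_zero _)
  right
  have key : ∀ a b : ℚ≥0, r + s ≤ a + b → (a = r ∧ b = s) ∨ P.coeff a * Q.coeff b = 0 := by
    intro a b hab
    rcases lt_or_ge r a with h | h
    · exact Or.inr (by rw [hr' a h, zero_mul])
    rcases lt_or_ge s b with h' | h'
    · exact Or.inr (by rw [hs' b h', mul_zero])
    left
    constructor
    · refine le_antisymm h ?_
      by_contra hc
      exact absurd hab (not_le.2 (add_lt_add_of_lt_of_le (not_le.1 hc) h'))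
    · refine le_antisymm h' ?_
      by_contra hc
      exact absurd hab (not_le.2 (add_lt_add_of_le_of_lt h (not_le.1 hc)))
  have hne : P.coeff r ≠ 0 := fun h => by simp [h] at hr
  have hne' : Q.coeff s ≠ 0 := fun h => by simp [h] at hs
  refine ⟨r + s, ?_, fun t ht => ?_⟩
  · have : (P * Q).coeff (r + s) = P.coeff r * Q.coeff s := by
      rw [AddMonoidAlgebra.coeff_mul, Finsupp.sum, Finset.sum_eq_single r]
      · rw [Finsupp.sum, Finset.sum_eq_single s]
        · simp
        · intro b _ hb
          rw [if_neg]
          exact fun h => hb (add_left_cancel h)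
        · intro h
          simp [Finsupp.notMem_support_iff.1 h]
      · intro a _ ha
        refine Finset.sum_eq_zero fun b _ => ?_
        dsimp only
        split_ifs with h
        · rcases key a b h.ge with h1 | h1
          · exact absurd h1.1 ha
          · exact h1
        · rfl
      · intro h
        exact absurd (Finsupp.notMem_support_iff.1 h) hne
    rw [this]
    simpa using mul_pos hr hs
  · rw [AddMonoidAlgebra.coeff_mul]
    refine Finset.sum_eq_zero fun a _ => Finset.sum_eq_zero fun b _ => ?_
    dsimp only
    split_ifs with h
    · rcases key a b (h ▸ ht.le) with h1 | h1
      · rw [← h, h1.1, h1.2] at ht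
        exact absurd ht (lt_irrefl _)
      · exact h1
    · rfl

theorem coeff_zero_mul (P Q : FracPoly) : (P * Q).coeff 0 = P.coeff 0 * Q.coeff 0 := by
  classical
  rw [AddMonoidAlgebra.coeff_mul, Finsupp.sum, Finset.sum_eq_single 0]
  · rw [Finsupp.sum, Finset.sum_eq_single 0]
    · simp
    · intro b _ hb
      simp [hb]
    · intro h
      simp [Finsupp.notMem_support_iff.1 h]
  · intro a _ ha
    refine Finset.sum_eq_zero fun b _ => ?_
    dsimp only
    rw [if_neg]
    exact fun h => ha (add_eq_zero.1 h).1
  · intro h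
    simp [Finsupp.notMem_support_iff.1 h]

/-- The elements of Shepherdson's model: the sums `∑ aᵣ X ^ r` which are zero or have positive
leading coefficient and whose constant coefficient is an integer. -/
noncomputable def shepherdson : Subsemiring FracPoly where
  carrier := {P | Nonneg P ∧ ∃ k : ℤ, P.coeff 0 = (k : RealAlg)}
  zero_mem' := ⟨Or.inl rfl, 0, by simp⟩
  one_mem' := by
    refine ⟨Or.inr ⟨0, ?_, fun s hs => ?_⟩, 1, ?_⟩
    · simp [AddMonoidAlgebra.one_def]
    · simp [AddMonoidAlgebra.one_def, hs.ne']
    · simp [AddMonoidAlgebra.one_def]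
  add_mem' := by
    rintro P Q ⟨hP, k, hk⟩ ⟨hQ, l, hl⟩
    exact ⟨hP.add hQ, k + l, by simp [hk, hl]⟩
  mul_mem' := by
    rintro P Q ⟨hP, k, hk⟩ ⟨hQ, l, hl⟩
    exact ⟨hP.mul hQ, k * l, by rw [coeff_zero_mul, hk, hl]; push_cast; rfl⟩

/-- The domain of Shepherdson's model. -/
abbrev Shepherdson : Type := shepherdson

/-- Shepherdson's model: the operations are those of formal sums, and `P ≤ Q` means that `Q - P`
is zero or has positive leading coefficient. -/
noncomputable instance : arith.Structure Shepherdson where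
  funMap
    | ArithFunc.zero, _ => 0
    | ArithFunc.one, _ => 1
    | ArithFunc.add, v => v 0 + v 1
    | ArithFunc.mul, v => v 0 * v 1
  RelMap
    | ArithRel.le, v => Nonneg ((v 1 : FracPoly) - (v 0 : FracPoly))

end Arith

/-! ### Degrees and top coefficients of formal sums -/

namespace Arith

/-! Open induction rests on one fact about the ordered ring `FracPoly`: the sign of a one-variable
polynomial over it changes only across finitely many elements of the ring (`tame_sgn`). In the model
a term with parameters is such a polynomial, so the truth value of an open formula changes only
across finitely many cut points. Each nonnegative cut point has an integer part in the model
(`exists_floor`), so a property that holds at 0 and passes to successors is carried past the cut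
points one by one (`TamePred.forall_of_succ`).

Sign changes are controlled by Newton's polygon, with no real closed field of Puiseux series. If `x`
has degree at most `r`, the top coefficient of `p(x)` is a real polynomial, the initial form of `p`,
evaluated at the coefficient of `X ^ r` in `x`; where this value is nonzero it gives the sign. A
root `a` of the initial form is real algebraic, so `a X ^ r` lies in the ring, and translating by it
leads to smaller exponents (`tame_near_zero`). The descent can stop at exponent 0, where the
elements in question are constants.

The claims on powers of two come from divisibility: only the constant coefficient is restricted to
integers, so it alone obstructs division by a positive integer. Parity is therefore the parity of
the constant coefficient, and a nonstandard element has an odd factor other than 1: the factor 3 if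
its constant coefficient is 0, else its quotient by the absolute value of that coefficient. Hence
powers of two are standard, and none is large enough for `X + 1`. -/

theorem coeff_mul_bounded {P Q : FracPoly} {r s : ℚ≥0} (hr : ∀ t, r < t → P.coeff t = 0)
    (hs : ∀ t, s < t → Q.coeff t = 0) :
    (P * Q).coeff (r + s) = P.coeff r * Q.coeff s ∧ ∀ t, r + s < t → (P * Q).coeff t = 0 := by
  classical
  have key : ∀ a b : ℚ≥0, r + s ≤ a + b → (a = r ∧ b = s) ∨ P.coeff a * Q.coeff b = 0 := by
    intro a b hab
    rcases lt_or_ge r a with h | h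
    · exact Or.inr (by rw [hr a h, zero_mul])
    rcases lt_or_ge s b with h' | h'
    · exact Or.inr (by rw [hs b h', mul_zero])
    left
    constructor
    · refine le_antisymm h ?_
      by_contra hc
      exact absurd hab (not_le.2 (add_lt_add_of_lt_of_le (not_le.1 hc) h'))
    · refine le_antisymm h' ?_
      by_contra hc
      exact absurd hab (not_le.2 (add_lt_add_of_le_of_lt h (not_le.1 hc)))
  constructor
  · rw [AddMonoidAlgebra.coeff_mul, Finsupp.sum, Finset.sum_eq_single r]
    · rw [Finsupp.sum, Finset.sum_eq_single s]
      · simp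
      · intro b _ hb
        rw [if_neg]
        exact fun h => hb (add_left_cancel h)
      · intro h
        simp [Finsupp.notMem_support_iff.1 h]
    · intro a _ ha
      refine Finset.sum_eq_zero fun b _ => ?_
      dsimp only
      split_ifs with h
      · rcases key a b h.ge with h1 | h1
        · exact absurd h1.1 ha
        · exact h1
      · rfl
    · intro h
      simp [Finsupp.notMem_support_iff.1 h]
  · intro t ht
    rw [AddMonoidAlgebra.coeff_mul]
    refine Finset.sum_eq_zero fun a _ => Finset.sum_eq_zero fun b _ => ?_
    dsimp only
    split_ifs with h
    · rcases key a b (h ▸ ht.le) with h1 | h1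
      · rw [← h, h1.1, h1.2] at ht
        exact absurd ht (lt_irrefl _)
      · exact h1
    · rfl

/-- The degree of a formal sum, with value `0` at the zero sum. -/
noncomputable def dg (f : FracPoly) : ℚ≥0 := f.coeff.support.sup id

/-- All exponents of `f` are at most `s`. -/
def Bdd (s : ℚ) (f : FracPoly) : Prop := ∀ t : ℚ≥0, s < t → f.coeff t = 0

/-- The coefficient of `f` at the exponent `s`, as a real number. -/
noncomputable def ld (s : ℚ) (f : FracPoly) : ℝ := if h : 0 ≤ s then (f.coeff ⟨s, h⟩ : ℝ) else 0

theorem ld_coe (s : ℚ≥0) (f : FracPoly) : ld (s : ℚ) f = f.coeff s := by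
  rw [ld, dif_pos s.cast_nonneg]
  rfl

theorem bdd_dg (f : FracPoly) : Bdd (dg f) f := by
  intro t ht
  by_contra h
  have : t ≤ dg f := Finset.le_sup (f := id) (Finsupp.mem_support_iff.2 h)
  exact absurd (NNRat.cast_lt.1 ht) (not_lt.2 this)

theorem ld_dg_ne {f : FracPoly} (hf : f ≠ 0) : ld (dg f) f ≠ 0 := by
  have hne : f.coeff.support.Nonempty := by
    rw [Finsupp.support_nonempty_iff]
    simpa using hf
  obtain ⟨a, ha, hs⟩ := Finset.exists_mem_eq_sup _ hne (id : ℚ≥0 → ℚ≥0)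
  rw [ld_coe]
  have : f.coeff (dg f) ≠ 0 := by
    rw [dg, hs]
    exact Finsupp.mem_support_iff.1 ha
  simpa using this

theorem Bdd.mono {s t : ℚ} {f : FracPoly} (h : Bdd s f) (hst : s ≤ t) : Bdd t f :=
  fun a ha => h a (hst.trans_lt ha)

theorem Bdd.ld_eq_zero {s t : ℚ} {f : FracPoly} (h : Bdd s f) (hst : s < t) : ld t f = 0 := by
  rw [ld]
  split_ifs with h0
  · rw [h ⟨t, h0⟩ hst]
    rfl
  · rfl

/-- Bounds range over all of `ℚ`, with `ld` equal to 0 at negative exponents, so that weights such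
as `m - i * r` need no case distinction. -/
theorem Bdd.eq_zero {s : ℚ} {f : FracPoly} (h : Bdd s f) (hs : s < 0) : f = 0 := by
  rw [← AddMonoidAlgebra.coeff_eq_zero]
  ext t
  rw [h t (hs.trans_le t.cast_nonneg)]
  rfl

theorem bdd_zero (s : ℚ) : Bdd s 0 := fun _ _ => rfl

theorem ld_zero (s : ℚ) : ld s 0 = 0 := by
  rw [ld]; split_ifs <;> rfl

theorem Bdd.add {s : ℚ} {f g : FracPoly} (hf : Bdd s f) (hg : Bdd s g) : Bdd s (f + g) :=
  fun t ht => by simp [hf t ht, hg t ht]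

theorem Bdd.neg {s : ℚ} {f : FracPoly} (hf : Bdd s f) : Bdd s (-f) :=
  fun t ht => by simp [hf t ht]

theorem Bdd.sub {s : ℚ} {f g : FracPoly} (hf : Bdd s f) (hg : Bdd s g) : Bdd s (f - g) :=
  fun t ht => by simp [hf t ht, hg t ht]

theorem ld_add (s : ℚ) (f g : FracPoly) : ld s (f + g) = ld s f + ld s g := by
  simp only [ld]
  split_ifs
  · rfl
  · simp

theorem ld_neg (s : ℚ) (f : FracPoly) : ld s (-f) = -ld s f := by
  simp only [ld]
  split_ifs
  · rfl
  · simp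

theorem ld_sub (s : ℚ) (f g : FracPoly) : ld s (f - g) = ld s f - ld s g := by
  rw [sub_eq_add_neg, ld_add, ld_neg, sub_eq_add_neg]

theorem Bdd.mul_and_ld {s t : ℚ} {f g : FracPoly} (hf : Bdd s f) (hg : Bdd t g) :
    Bdd (s + t) (f * g) ∧ ld (s + t) (f * g) = ld s f * ld t g := by
  rcases lt_or_ge s 0 with hs | hs
  · rw [hf.eq_zero hs, zero_mul, ld_zero, ld_zero, zero_mul]
    exact ⟨bdd_zero _, rfl⟩
  rcases lt_or_ge t 0 with ht | ht
  · rw [hg.eq_zero ht, mul_zero, ld_zero, ld_zero, mul_zero]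
    exact ⟨bdd_zero _, rfl⟩
  lift s to ℚ≥0 using hs
  lift t to ℚ≥0 using ht
  obtain ⟨h1, h2⟩ := coeff_mul_bounded (P := f) (Q := g) (r := s) (s := t)
    (fun a ha => hf a (NNRat.cast_lt.2 ha)) (fun a ha => hg a (NNRat.cast_lt.2 ha))
  rw [← NNRat.cast_add]
  refine ⟨fun a ha => h2 a (NNRat.cast_lt.1 ha), ?_⟩
  rw [ld_coe, ld_coe, ld_coe, h1]
  rfl

theorem Bdd.mul {s t : ℚ} {f g : FracPoly} (hf : Bdd s f) (hg : Bdd t g) : Bdd (s + t) (f * g) :=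
  (hf.mul_and_ld hg).1

theorem ld_mul {s t : ℚ} {f g : FracPoly} (hf : Bdd s f) (hg : Bdd t g) :
    ld (s + t) (f * g) = ld s f * ld t g :=
  (hf.mul_and_ld hg).2

theorem bdd_single (s : ℚ≥0) (c : RealAlg) : Bdd s (AddMonoidAlgebra.single s c) := by
  intro t ht
  have h : s ≠ t := fun h => by simp [h] at ht
  simp [h.symm]

theorem ld_single (s : ℚ≥0) (c : RealAlg) : ld s (AddMonoidAlgebra.single s c) = c := by
  rw [ld_coe]
  simp

theorem bdd_one : Bdd 0 1 := by
  have := bdd_single 0 1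
  rwa [NNRat.cast_zero] at this

theorem ld_one : ld 0 1 = 1 := by
  have := ld_single 0 1
  rwa [NNRat.cast_zero] at this

theorem Bdd.pow {s : ℚ} {f : FracPoly} (hf : Bdd s f) (n : ℕ) : Bdd (n * s) (f ^ n) := by
  induction n with
  | zero => simpa using bdd_one
  | succ n ih =>
    rw [pow_succ]
    convert ih.mul hf using 1
    push_cast; ring

theorem ld_pow {s : ℚ} {f : FracPoly} (hf : Bdd s f) (n : ℕ) :
    ld (n * s) (f ^ n) = ld s f ^ n := by
  induction n with
  | zero => simpa using ld_one
  | succ n ih =>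
    rw [pow_succ, pow_succ, ← ih, ← ld_mul (hf.pow n) hf]
    congr 1
    push_cast; ring

theorem bdd_sum {ι : Type} (s : Finset ι) (m : ℚ) (f : ι → FracPoly) (h : ∀ i ∈ s, Bdd m (f i)) :
    Bdd m (∑ i ∈ s, f i) := by
  classical
  induction s using Finset.induction_on with
  | empty => simpa using bdd_zero m
  | insert a s ha ih =>
    rw [Finset.sum_insert ha]
    exact (h a (by simp)).add (ih fun i hi => h i (by simp [hi]))

theorem ld_sum {ι : Type} (s : Finset ι) (m : ℚ) (f : ι → FracPoly) :
    ld m (∑ i ∈ s, f i) = ∑ i ∈ s, ld m (f i) := by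
  classical
  induction s using Finset.induction_on with
  | empty => simpa using ld_zero m
  | insert a s ha ih =>
    rw [Finset.sum_insert ha, Finset.sum_insert ha, ld_add, ih]

theorem ld_nsmul (n : ℕ) (m : ℚ) (f : FracPoly) : ld m ((n : FracPoly) * f) = n * ld m f := by
  induction n with
  | zero => simp [ld_zero]
  | succ n ih => push_cast; rw [add_mul, ld_add, ih]; simp [add_mul]

theorem Bdd.natCast_mul {m : ℚ} {f : FracPoly} (hf : Bdd m f) (n : ℕ) : Bdd m ((n : FracPoly) * f) := by
  induction n with
  | zero => simpa using bdd_zero m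
  | succ n ih => push_cast; rw [add_mul, one_mul]; exact ih.add hf

/-! ### The order of formal sums -/

theorem nonneg_of_ld {s : ℚ} {f : FracPoly} (hf : Bdd s f) (h : 0 < ld s f) : Nonneg f := by
  have hs : 0 ≤ s := by
    by_contra hs
    rw [hf.eq_zero (not_le.1 hs), ld_zero] at h
    exact lt_irrefl _ h
  lift s to ℚ≥0 using hs
  exact Or.inr ⟨s, by rwa [ld_coe] at h, fun t ht => hf t (NNRat.cast_lt.2 ht)⟩

theorem nonneg_iff (f : FracPoly) : Nonneg f ↔ 0 ≤ ld (dg f) f := by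
  constructor
  · rintro (rfl | ⟨r, hr, hr'⟩)
    · rw [ld_zero]
    · have hf : f ≠ 0 := by rintro rfl; simp at hr
      have hB : Bdd r f := fun t ht => hr' t (NNRat.cast_lt.1 ht)
      have h1 : (r : ℚ) = dg f := by
        rcases lt_trichotomy (r : ℚ) (dg f) with h | h | h
        · exact absurd (hB.ld_eq_zero h) (ld_dg_ne hf)
        · exact h
        · have := (bdd_dg f).ld_eq_zero h
          rw [ld_coe] at this
          exact absurd this hr.ne'
      rw [← h1, ld_coe]
      exact hr.le
  · intro h
    by_cases hf : f = 0
    · exact Or.inl hf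
    · exact nonneg_of_ld (bdd_dg f) (lt_of_le_of_ne h (ld_dg_ne hf).symm)

theorem dg_neg (f : FracPoly) : dg (-f) = dg f := by
  simp [dg]

theorem nonneg_total (f : FracPoly) : Nonneg f ∨ Nonneg (-f) := by
  rw [nonneg_iff, nonneg_iff, dg_neg, ld_neg, neg_nonneg]
  exact le_total _ _

theorem nonneg_antisymm {f : FracPoly} (h : Nonneg f) (h' : Nonneg (-f)) : f = 0 := by
  rw [nonneg_iff] at h h'
  rw [dg_neg, ld_neg, neg_nonneg] at h'
  by_contra hf
  exact ld_dg_ne hf (le_antisymm h' h)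

theorem nonneg_one : Nonneg 1 := nonneg_of_ld bdd_one (by rw [ld_one]; exact one_pos)

-- The order is put on the whole ring and not only on the model, because cut points may have
-- non-integral constant coefficient or be negative.
open Classical in
noncomputable instance : LinearOrder FracPoly where
  le f g := Nonneg (g - f)
  le_refl f := Or.inl (sub_self f)
  le_trans f g h h1 h2 := by
    have := Nonneg.add h1 h2
    rwa [show g - f + (h - g) = h - f by ring] at this
  le_antisymm f g h1 h2 := by
    refine (sub_eq_zero.1 (nonneg_antisymm h1 ?_)).symm
    rwa [neg_sub]
  le_total f g := by
    have := nonneg_total (g - f)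
    rwa [neg_sub] at this
  toDecidableLE := Classical.decRel _

theorem le_def (f g : FracPoly) : f ≤ g ↔ Nonneg (g - f) := Iff.rfl

instance : IsOrderedAddMonoid FracPoly where
  add_le_add_left f g h a := by
    rw [le_def] at h ⊢
    rwa [add_sub_add_right_eq_sub]

theorem nonneg_iff_le (f : FracPoly) : Nonneg f ↔ 0 ≤ f := by
  rw [le_def, sub_zero]

theorem pos_of_ld {s : ℚ} {f : FracPoly} (hf : Bdd s f) (h : 0 < ld s f) : 0 < f := by
  refine lt_of_le_of_ne ((nonneg_iff_le f).1 (nonneg_of_ld hf h)) ?_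
  rintro rfl
  rw [ld_zero] at h
  exact lt_irrefl _ h

instance : IsStrictOrderedRing FracPoly :=
  haveI : ZeroLEOneClass FracPoly := ⟨(nonneg_iff_le 1).1 nonneg_one⟩
  haveI : Nontrivial FracPoly := inferInstance
  .of_mul_pos fun f g hf hg => by
    have h : ∀ h : FracPoly, 0 < h → 0 < ld (dg h) h := fun h hh =>
      lt_of_le_of_ne ((nonneg_iff h).1 ((nonneg_iff_le h).2 hh.le)) (ld_dg_ne hh.ne').symm
    exact pos_of_ld ((bdd_dg f).mul (bdd_dg g))
      (by rw [ld_mul (bdd_dg f) (bdd_dg g)]; exact mul_pos (h f hf) (h g hg))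

theorem sign_of_ld {s : ℚ} {f : FracPoly} (hf : Bdd s f) (h : ld s f ≠ 0) :
    SignType.sign f = SignType.sign (ld s f) := by
  rcases lt_or_gt_of_ne h with h | h
  · have : 0 < -f := pos_of_ld hf.neg (by rw [ld_neg]; linarith)
    rw [sign_neg h, sign_neg (by simpa using this)]
  · rw [sign_pos h, sign_pos (pos_of_ld hf h)]

theorem ld_le_ld {s : ℚ} {f g : FracPoly} (hf : Bdd s f) (hg : Bdd s g) (h : f ≤ g) :
    ld s f ≤ ld s g := by
  by_contra hlt
  have := pos_of_ld (hf.sub hg) (by rw [ld_sub]; linarith)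
  linarith

/-- Convexity: an element of degree above `s` exceeds in absolute value everything of degree at most
`s`. -/
theorem Bdd.of_abs_le {s : ℚ} {f g : FracPoly} (hg : Bdd s g) (h1 : -g ≤ f) (h2 : f ≤ g) :
    Bdd s f := by
  by_contra hf
  have h0 : f ≠ 0 := by rintro rfl; exact hf (bdd_zero s)
  have hs : s < dg f := by
    by_contra h
    exact hf ((bdd_dg f).mono (not_lt.1 h))
  have hgd : Bdd (dg f) g := hg.mono hs.le
  have hz := hg.ld_eq_zero hs
  have e1 := ld_le_ld hgd.neg (bdd_dg f) h1
  have e2 := ld_le_ld (bdd_dg f) hgd h2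
  rw [ld_neg, hz] at e1
  rw [hz] at e2
  exact ld_dg_ne h0 (by linarith)

/-! ### Functions with finitely many jumps -/

/-- On `J`, the function `f` changes its value only across finitely many cut points. -/
def Tame {R α : Type} [LinearOrder R] (f : R → α) (J : Set R) : Prop :=
  ∃ C : Finset R, ∀ x ∈ J, ∀ y ∈ J, x < y → (∀ c ∈ C, ¬ (x ≤ c ∧ c ≤ y)) → f x = f y

theorem Tame.mono {R α : Type} [LinearOrder R] {f : R → α} {J K : Set R} (h : Tame f K)
    (hJ : J ⊆ K) : Tame f J := by
  obtain ⟨C, hC⟩ := h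
  exact ⟨C, fun x hx y hy => hC x (hJ hx) y (hJ hy)⟩

theorem Tame.of_const {R α : Type} [LinearOrder R] {f : R → α} {J : Set R} (a : α)
    (h : ∀ x ∈ J, f x = a) : Tame f J :=
  ⟨∅, fun x hx y hy _ _ => by rw [h x hx, h y hy]⟩

/-- With `z` as an additional cut point, any pair still to be compared lies strictly on one side of
`z`. The value at `z` itself is left uncontrolled. -/
theorem Tame.glue {R α : Type} [LinearOrder R] {f : R → α} {J K₁ K₂ : Set R} (h₁ : Tame f K₁)
    (h₂ : Tame f K₂) (z : R) (hJ₁ : ∀ x ∈ J, x < z → x ∈ K₁) (hJ₂ : ∀ x ∈ J, z < x → x ∈ K₂) :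
    Tame f J := by
  classical
  obtain ⟨C₁, hC₁⟩ := h₁
  obtain ⟨C₂, hC₂⟩ := h₂
  refine ⟨insert z (C₁ ∪ C₂), fun x hx y hy hxy hc => ?_⟩
  have hz := hc z (by simp)
  rcases lt_or_ge z x with h | h
  · exact hC₂ x (hJ₂ x hx h) y (hJ₂ y hy (h.trans hxy)) hxy fun c hc' => hc c (by simp [hc'])
  · have hy' : y < z := not_le.1 fun h' => hz ⟨h, h'⟩
    exact hC₁ x (hJ₁ x hx (hxy.trans hy')) y (hJ₁ y hy hy') hxy fun c hc' => hc c (by simp [hc'])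

theorem Tame.comp_strictMono {R α : Type} [LinearOrder R] {f : R → α} {J K : Set R}
    (h : Tame f K) (e : R ≃o R) (hJ : ∀ x ∈ J, e x ∈ K) : Tame (fun x => f (e x)) J := by
  classical
  obtain ⟨C, hC⟩ := h
  refine ⟨C.image e.symm, fun x hx y hy hxy hc => hC _ (hJ x hx) _ (hJ y hy) (e.lt_iff_lt.2 hxy) ?_⟩
  intro c hcC ⟨h1, h2⟩
  exact hc (e.symm c) (Finset.mem_image_of_mem _ hcC)
    ⟨(e.le_symm_apply).2 h1, (e.symm_apply_le).2 h2⟩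

/-- Compactness of `[-M, M]`: a Lebesgue number for the local neighbourhoods leaves finitely many
short intervals of values of `ld r`, which are glued one after the other. -/
theorem tame_leading_le {α : Type} {f : FracPoly → α} {r : ℚ≥0}
    (h : ∀ c : ℝ, ∃ ε > 0, Tame f {x | Bdd r x ∧ |ld r x - c| < ε}) (M : ℕ) :
    Tame f {x | Bdd r x ∧ |ld r x| ≤ M} := by
  choose ε hε hT using h
  obtain ⟨δ, hδ, hcov⟩ := lebesgue_number_lemma_of_metric (isCompact_Icc (a := -(M : ℝ)) (b := M))
    (c := fun c : ℝ => Metric.ball c (ε c)) (fun _ => Metric.isOpen_ball)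
    (fun x _ => Set.mem_iUnion.2 ⟨x, Metric.mem_ball_self (hε x)⟩)
  obtain ⟨N, hN⟩ := exists_nat_one_div_lt hδ
  have key : ∀ j : ℕ, j ≤ 2 * M * (N + 1) →
      Tame f {x | Bdd r x ∧ -(M : ℝ) ≤ ld r x ∧ ld r x ≤ -M + j / (N + 1)} := by
    have hN0 : (0 : ℝ) < N + 1 := by positivity
    have piece : ∀ a ∈ Set.Icc (-(M : ℝ)) M, ∃ b,
        {x | Bdd r x ∧ a ≤ ld r x ∧ ld r x ≤ a + 1 / (N + 1)} ⊆
          {x | Bdd r x ∧ |ld r x - b| < ε b} := by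
      intro a ha
      obtain ⟨b, hb⟩ := hcov a ha
      refine ⟨b, fun x hx => ⟨hx.1, ?_⟩⟩
      have : ld r x ∈ Metric.ball a δ := by
        rw [Metric.mem_ball, Real.dist_eq, abs_lt]
        constructor <;> linarith [hx.2.1, hx.2.2]
      exact hb this
    intro j
    induction j with
    | zero =>
      intro _
      obtain ⟨b, hb⟩ := piece (-M) ⟨le_rfl, by linarith [(Nat.cast_nonneg M : (0 : ℝ) ≤ M)]⟩
      refine (hT b).mono fun x hx => hb ⟨hx.1, hx.2.1, hx.2.2.trans ?_⟩
      have : 0 < 1 / ((N : ℝ) + 1) := by positivity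
      simp only [CharP.cast_eq_zero, zero_div, add_zero]
      linarith
    | succ j ih =>
      intro hj
      have hj' : ((j : ℝ) + 1) ≤ 2 * M * (N + 1) := by exact_mod_cast hj
      obtain ⟨b, hb⟩ := piece (-M + j / (N + 1)) (by
        constructor
        · have : 0 ≤ (j : ℝ) / (N + 1) := by positivity
          linarith
        · have : (j : ℝ) / (N + 1) ≤ 2 * M := by
            rw [div_le_iff₀ hN0]
            linarith
          linarith)
      -- The endpoints of the intervals are rational, so monomials with these coefficients exist in
      -- the ring and serve as cut points.
      have hz : ((-(M : ℚ) + j / (N + 1) : ℚ) : RealAlg) = ((-M + j / (N + 1) : ℝ) : ℝ) := by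
        push_cast
        rfl
      refine (ih (by omega)).glue (hT b)
        (AddMonoidAlgebra.single r ((-(M : ℚ) + j / (N + 1) : ℚ) : RealAlg)) ?_ ?_
      · intro x hx hxz
        have := ld_le_ld hx.1 (bdd_single r _) hxz.le
        rw [ld_single, hz] at this
        exact ⟨hx.1, hx.2.1, this⟩
      · intro x hx hxz
        have := ld_le_ld (bdd_single r _) hx.1 hxz.le
        rw [ld_single, hz] at this
        refine hb ⟨hx.1, this, hx.2.2.trans (le_of_eq ?_)⟩
        push_cast
        ring
  refine (key (2 * M * (N + 1)) le_rfl).mono fun x hx => ?_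
  have hN0 : (0 : ℝ) < N + 1 := by positivity
  have h2 := abs_le.1 hx.2
  refine ⟨hx.1, h2.1, h2.2.trans (le_of_eq ?_)⟩
  push_cast
  field_simp
  ring

/-! ### Signs of real polynomials -/

open Polynomial in
theorem sign_eval_eventually_eq (φ : ℝ[X]) {c : ℝ} (hc : φ.eval c ≠ 0) :
    ∃ ε > 0, ∀ x, |x - c| < ε → SignType.sign (φ.eval x) = SignType.sign (φ.eval c) := by
  have hcont : ContinuousAt (fun x => φ.eval x) c := φ.continuous.continuousAt
  obtain ⟨ε, hε, h⟩ := Metric.continuousAt_iff.1 hcont |φ.eval c| (abs_pos.2 hc)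
  refine ⟨ε, hε, fun x hx => ?_⟩
  have := h (x := x) (by rwa [Real.dist_eq])
  rw [Real.dist_eq] at this
  rcases lt_or_gt_of_ne hc with h0 | h0
  · rw [abs_of_neg h0, abs_lt] at this
    rw [sign_neg h0, sign_neg (by linarith)]
  · rw [abs_of_pos h0, abs_lt] at this
    rw [sign_pos h0, sign_pos (by linarith)]

open Polynomial in
theorem sign_eval_near_zero (φ : ℝ[X]) {d : ℕ} (hd : φ.coeff d ≠ 0) (hlt : ∀ i < d, φ.coeff i = 0) :
    ∃ ε > 0, ∀ x, |x| < ε →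
      SignType.sign (φ.eval x) = SignType.sign (φ.coeff d) * SignType.sign x ^ d := by
  obtain ⟨ψ, rfl⟩ := X_pow_dvd_iff.2 hlt
  have h0 : (X ^ d * ψ).coeff d = ψ.eval 0 := by
    rw [← coeff_zero_eq_eval_zero]
    simpa using coeff_X_pow_mul ψ d 0
  rw [h0] at hd ⊢
  obtain ⟨ε, hε, h⟩ := sign_eval_eventually_eq ψ hd
  refine ⟨ε, hε, fun x hx => ?_⟩
  rw [eval_mul, eval_pow, eval_X, sign_mul, sign_pow, h x (by simpa using hx), mul_comm]

open Polynomial in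
-- Apply continuity at 0 to the reversed polynomial, evaluated at `1 / x`.
theorem sign_eval_near_infinity (φ : ℝ[X]) (hφ : φ ≠ 0) :
    ∃ M : ℕ, ∀ x : ℝ, M < |x| →
      SignType.sign (φ.eval x) = SignType.sign φ.leadingCoeff * SignType.sign x ^ φ.natDegree := by
  have h0 : φ.reverse.eval 0 = φ.leadingCoeff := by
    rw [← coeff_zero_eq_eval_zero, coeff_zero_reverse]
  obtain ⟨ε, hε, h⟩ := sign_eval_eventually_eq φ.reverse (c := 0)
    (by rw [h0]; exact leadingCoeff_ne_zero.2 hφ)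
  obtain ⟨M, hM⟩ := exists_nat_gt ε⁻¹
  refine ⟨M, fun x hx => ?_⟩
  have hx1 : ε⁻¹ < |x| := hM.trans hx
  have hx0 : x ≠ 0 := by
    rintro rfl
    rw [abs_zero] at hx1
    exact absurd hx1 (not_lt.2 (inv_nonneg.2 hε.le))
  let := invertibleOfNonzero hx0
  have := eval₂_reverse_mul_pow (RingHom.id ℝ) x φ
  rw [← eval, ← eval, invOf_eq_inv] at this
  rw [← this, sign_mul, sign_pow, h, h0]
  rw [sub_zero, abs_inv]
  exact inv_lt_of_inv_lt₀ hε hx1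

/-! ### Initial forms -/

open Polynomial

/-- The initial form of `p` of weight `m`, when the variable has weight `r`. -/
noncomputable def ini (m r : ℚ) (p : FracPoly[X]) : ℝ[X] :=
  ∑ i ∈ Finset.range (p.natDegree + 1), C (ld (m - i * r) (p.coeff i)) * X ^ i

theorem coeff_ini (m r : ℚ) (p : FracPoly[X]) (i : ℕ) :
    (ini m r p).coeff i = ld (m - i * r) (p.coeff i) := by
  rw [ini, finsetSum_coeff]
  simp only [coeff_C_mul_X_pow]
  rw [Finset.sum_ite_eq, if_congr Finset.mem_range rfl rfl]
  split_ifs with h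
  · rfl
  · rw [coeff_eq_zero_of_natDegree_lt (by omega), ld_zero]

/-- The hypothesis says that each monomial of `p` has weight at most `m` when the variable has
weight `r`; only the parts of weight exactly `m` reach the coefficient at `m`. -/
theorem eval_weighted {m r : ℚ} {p : FracPoly[X]} (h : ∀ i : ℕ, Bdd (m - i * r) (p.coeff i))
    {x : FracPoly} (hx : Bdd r x) :
    Bdd m (p.eval x) ∧ ld m (p.eval x) = (ini m r p).eval (ld r x) := by
  rw [eval_eq_sum_range]
  constructor
  · refine bdd_sum _ _ _ fun i _ => ?_
    have := (h i).mul (hx.pow i)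
    rwa [sub_add_cancel] at this
  · rw [ld_sum, ini, eval_finsetSum]
    refine Finset.sum_congr rfl fun i _ => ?_
    have := ld_mul (h i) (hx.pow i)
    rw [sub_add_cancel] at this
    rw [this, ld_pow hx, eval_mul, eval_C, eval_pow, eval_X]

theorem bdd_hasseDeriv {m r : ℚ} {p : FracPoly[X]} (h : ∀ i : ℕ, Bdd (m - i * r) (p.coeff i))
    (k i : ℕ) : Bdd (m - k * r - i * r) ((hasseDeriv k p).coeff i) := by
  rw [hasseDeriv_coeff]
  refine Bdd.natCast_mul ?_ _
  convert h (i + k) using 1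
  push_cast; ring

theorem ini_hasseDeriv (m r : ℚ) (p : FracPoly[X]) (k : ℕ) :
    ini (m - k * r) r (hasseDeriv k p) = hasseDeriv k (ini m r p) := by
  ext i
  rw [coeff_ini, hasseDeriv_coeff, hasseDeriv_coeff, coeff_ini, ld_nsmul]
  congr 2
  push_cast; ring

theorem bdd_taylor {m r : ℚ} {p : FracPoly[X]} (h : ∀ i : ℕ, Bdd (m - i * r) (p.coeff i))
    {a : FracPoly} (ha : Bdd r a) (i : ℕ) : Bdd (m - i * r) ((taylor a p).coeff i) := by
  rw [taylor_coeff]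
  exact (eval_weighted (bdd_hasseDeriv h i) ha).1

/-- Taylor coefficients are values of Hasse derivatives, and these commute with initial forms. -/
theorem ini_taylor {m r : ℚ} {p : FracPoly[X]} (h : ∀ i : ℕ, Bdd (m - i * r) (p.coeff i))
    {a : FracPoly} (ha : Bdd r a) : ini m r (taylor a p) = taylor (ld r a) (ini m r p) := by
  ext i
  rw [coeff_ini, taylor_coeff, taylor_coeff, (eval_weighted (bdd_hasseDeriv h i) ha).2,
    ini_hasseDeriv]

/-- The formal sums in `X ^ (1 / N)`. -/
noncomputable def denomSubring (N : ℕ) : Subring FracPoly where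
  carrier := {f | ∀ s, f.coeff s ≠ 0 → ∃ k : ℕ, (N : ℚ≥0) * s = k}
  zero_mem' := fun s hs => absurd rfl hs
  one_mem' := fun s hs => by
    refine ⟨0, ?_⟩
    by_cases h : s = 0
    · simp [h]
    · exact absurd (by simp [AddMonoidAlgebra.one_def, h]) hs
  add_mem' := fun {f g} hf hg s hs => by
    by_cases h : f.coeff s = 0
    · exact hg s fun h' => hs (by simp [h, h'])
    · exact hf s h
  neg_mem' := fun {f} hf s hs => hf s fun h => hs (by simp [h])
  mul_mem' := fun {f g} hf hg s hs => by
    classical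
    rw [AddMonoidAlgebra.coeff_mul] at hs
    obtain ⟨a, ha, hs⟩ := Finset.exists_ne_zero_of_sum_ne_zero hs
    obtain ⟨b, hb, hs⟩ := Finset.exists_ne_zero_of_sum_ne_zero hs
    dsimp only at hs
    split_ifs at hs with h
    · obtain ⟨k, hk⟩ := hf a (Finsupp.mem_support_iff.1 ha)
      obtain ⟨l, hl⟩ := hg b (Finsupp.mem_support_iff.1 hb)
      exact ⟨k + l, by rw [← h, mul_add, hk, hl]; push_cast; rfl⟩
    · exact absurd rfl hs

theorem exists_denom_finset (S : Finset ℚ≥0) :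
    ∃ N : ℕ, 0 < N ∧ ∀ s ∈ S, ∃ k : ℕ, (N : ℚ≥0) * s = k := by
  classical
  refine ⟨∏ s ∈ S, s.den, Finset.prod_pos fun s _ => s.den_pos, fun s hs => ?_⟩
  rw [← Finset.mul_prod_erase S _ hs]
  refine ⟨(∏ x ∈ S.erase s, x.den) * s.num, ?_⟩
  push_cast
  rw [mul_right_comm, NNRat.den_mul_eq_num, mul_comm]

/-- A common denominator makes the exponents discrete; this is what terminates the descent in
`tame_near_zero`. -/
theorem exists_denom (p : FracPoly[X]) :
    ∃ N : ℕ, 0 < N ∧ ∀ i, p.coeff i ∈ denomSubring N := by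
  classical
  obtain ⟨N, hN, h⟩ := exists_denom_finset (p.support.biUnion fun i => (p.coeff i).coeff.support)
  refine ⟨N, hN, fun i s hs => h s (Finset.mem_biUnion.2 ⟨i, ?_, Finsupp.mem_support_iff.2 hs⟩)⟩
  rw [mem_support_iff]
  intro h0
  rw [h0] at hs
  exact hs rfl

theorem taylor_coeff_mem {N : ℕ} {p : FracPoly[X]} (h : ∀ i, p.coeff i ∈ denomSubring N)
    {a : FracPoly} (ha : a ∈ denomSubring N) (i : ℕ) : (taylor a p).coeff i ∈ denomSubring N := by
  rw [taylor_coeff, eval_eq_sum_range]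
  refine sum_mem fun j _ => mul_mem ?_ (pow_mem ha j)
  rw [hasseDeriv_coeff]
  exact mul_mem (natCast_mem _ _) (h _)

theorem single_mem_denomSubring {N : ℕ} {r : ℚ≥0} {k : ℕ} (h : (N : ℚ≥0) * r = k) (c : RealAlg) :
    AddMonoidAlgebra.single r c ∈ denomSubring N := by
  intro s hs
  refine ⟨k, ?_⟩
  by_cases hrs : s = r
  · rw [hrs, h]
  · exact absurd (by simp [hrs]) hs

/-- A real root of a nonzero initial form is a real algebraic number. -/
theorem exists_realAlg_of_root {m r : ℚ} {p : FracPoly[X]} (h0 : ini m r p ≠ 0) {c : ℝ}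
    (hc : (ini m r p).eval c = 0) : ∃ a : RealAlg, (a : ℝ) = c := by
  have hl : ∀ s f, ∃ a : RealAlg, (a : ℝ) = ld s f := by
    intro s f
    rw [ld]
    split_ifs with h
    · exact ⟨_, rfl⟩
    · exact ⟨0, rfl⟩
  choose g hg using hl
  have hmap : ini m r p = (∑ i ∈ Finset.range (p.natDegree + 1),
      C (g (m - i * r) (p.coeff i)) * X ^ i : RealAlg[X]).map (algebraMap RealAlg ℝ) := by
    rw [ini, Polynomial.map_sum]
    refine Finset.sum_congr rfl fun i _ => ?_
    rw [Polynomial.map_mul, map_C, Polynomial.map_pow, map_X]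
    congr 2
    exact (hg _ _).symm
  have halg : IsAlgebraic RealAlg c := by
    refine ⟨∑ i ∈ Finset.range (p.natDegree + 1),
      C (g (m - i * r) (p.coeff i)) * X ^ i, fun h => h0 ?_, ?_⟩
    · rw [hmap, h, Polynomial.map_zero]
    · rw [aeval_def, ← eval_map, ← hmap, hc]
  have halg' : IsAlgebraic ℚ c :=
    @IsAlgebraic.restrictScalars ℚ RealAlg ℝ _ _ _ (algebraicClosure ℚ ℝ).algebra' _ _ _ _
      (algebraicClosure.isAlgebraic ℚ ℝ) c halg
  exact ⟨⟨c, mem_algebraicClosure_iff.2 halg'⟩, rfl⟩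

/-! ### Newton's polygon and finiteness of sign changes -/

theorem Bdd.dg_le {s : ℚ} {f : FracPoly} (h : Bdd s f) (hf : f ≠ 0) : (dg f : ℚ) ≤ s := by
  by_contra hlt
  exact ld_dg_ne hf (h.ld_eq_zero (not_le.1 hlt))

/-- The sign of the values of `p`. -/
noncomputable def sgn (p : FracPoly[X]) (x : FracPoly) : SignType := SignType.sign (p.eval x)

theorem sgn_eq_of_ini {m r : ℚ} {p : FracPoly[X]} (h : ∀ i : ℕ, Bdd (m - i * r) (p.coeff i))
    {x : FracPoly} (hx : Bdd r x) (h0 : (ini m r p).eval (ld r x) ≠ 0) :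
    sgn p x = SignType.sign ((ini m r p).eval (ld r x)) := by
  obtain ⟨h1, h2⟩ := eval_weighted h hx
  rw [← h2] at h0 ⊢
  exact sign_of_ld h1 h0

theorem tame_of_ini_ne {m : ℚ} {r : ℚ≥0} {p : FracPoly[X]}
    (h : ∀ i : ℕ, Bdd (m - i * r) (p.coeff i)) {c : ℝ} (hc : (ini m r p).eval c ≠ 0) :
    ∃ ε > 0, Tame (sgn p) {x | Bdd r x ∧ |ld r x - c| < ε} := by
  obtain ⟨ε, hε, H⟩ := sign_eval_eventually_eq _ hc
  refine ⟨ε, hε, Tame.of_const (SignType.sign ((ini m r p).eval c)) fun x hx => ?_⟩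
  have := H _ hx.2
  rw [sgn_eq_of_ini h hx.1, this]
  intro h0
  rw [h0, sign_zero, eq_comm, sign_eq_zero_iff] at this
  exact hc this

theorem tame_of_taylor {r : ℚ≥0} {p : FracPoly[X]} {a : FracPoly} (ha : Bdd r a) {ε : ℝ}
    (h : Tame (sgn (taylor a p)) {x | Bdd r x ∧ |ld r x| < ε}) :
    Tame (sgn p) {x | Bdd r x ∧ |ld r x - ld r a| < ε} := by
  have := h.comp_strictMono (J := {x | Bdd r x ∧ |ld r x - ld r a| < ε}) (OrderIso.subRight a)
    fun x hx => ⟨hx.1.sub ha, by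
      rw [OrderIso.subRight_apply, ld_sub]
      exact hx.2⟩
  convert this using 2 with x
  rw [sgn, sgn, taylor_eval, OrderIso.subRight_apply, sub_add_cancel]

theorem tame_of_signs {p : FracPoly[X]} {J : Set FracPoly} {u : SignType} {d : ℕ}
    (h : ∀ x ∈ J, x ≠ 0 → sgn p x = u * SignType.sign x ^ d) : Tame (sgn p) J := by
  refine Tame.glue (K₁ := {x | x ∈ J ∧ x < 0}) (K₂ := {x | x ∈ J ∧ 0 < x})
    (Tame.of_const (u * (-1) ^ d) ?_) (Tame.of_const (u * 1 ^ d) ?_) 0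
    (fun x hx hx0 => ⟨hx, hx0⟩) (fun x hx hx0 => ⟨hx, hx0⟩)
  · intro x hx
    rw [h x hx.1 hx.2.ne, sign_neg hx.2]
  · intro x hx
    rw [h x hx.1 hx.2.ne', sign_pos hx.2]

/-- Beyond `± (M + 1) X ^ r` the sign is that of the leading term of the initial form, constant on
either side; between these two cut points compactness combines the local statements. -/
theorem tame_of_outer {m : ℚ} {r : ℚ≥0} {p : FracPoly[X]} {J : Set FracPoly}
    (hw : ∀ i : ℕ, Bdd (m - i * r) (p.coeff i)) (h0 : ini m r p ≠ 0)
    (hout : ∀ x ∈ J, ¬ Bdd r x → sgn p x =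
      SignType.sign (ini m r p).leadingCoeff * SignType.sign x ^ (ini m r p).natDegree)
    (hloc : ∀ c : ℝ, ∃ ε > 0, Tame (sgn p) {x | Bdd r x ∧ |ld r x - c| < ε}) :
    Tame (sgn p) J := by
  obtain ⟨M, hM⟩ := sign_eval_near_infinity _ h0
  have hmid := tame_leading_le hloc (M + 1)
  set z : FracPoly := AddMonoidAlgebra.single r ((M + 1 : ℚ) : RealAlg) with hz
  have hzB : Bdd r z := bdd_single r _
  have hzld : ld r z = M + 1 := by
    rw [hz, ld_single]
    push_cast
    rfl
  have hz0 : 0 < z := pos_of_ld hzB (by rw [hzld]; positivity)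
  have hbig : ∀ x ∈ J, (Bdd r x → (M : ℝ) < |ld r x|) → sgn p x =
      SignType.sign (ini m r p).leadingCoeff * SignType.sign x ^ (ini m r p).natDegree := by
    intro x hx hx'
    by_cases hB : Bdd r x
    · have h1 := hM _ (hx' hB)
      have hne : ld r x ≠ 0 := by
        intro h
        have := hx' hB
        rw [h, abs_zero] at this
        exact absurd this (not_lt.2 (Nat.cast_nonneg M))
      rw [sgn_eq_of_ini hw hB, h1, sign_of_ld hB hne]
      intro h
      rw [h, sign_zero, eq_comm, mul_eq_zero, sign_eq_zero_iff, leadingCoeff_eq_zero] at h1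
      rcases h1 with h1 | h1
      · exact h0 h1
      · exact hne (sign_eq_zero_iff.1 (eq_zero_of_pow_eq_zero h1))
    · exact hout x hx hB
  have hpos : Tame (sgn p) {x | x ∈ J ∧ z < x} := by
    refine Tame.of_const (SignType.sign (ini m r p).leadingCoeff * 1 ^ (ini m r p).natDegree) ?_
    rintro x ⟨hx, hzx⟩
    rw [hbig x hx, sign_pos (hz0.trans hzx)]
    intro hB
    have := ld_le_ld hzB hB hzx.le
    rw [hzld] at this
    exact lt_of_lt_of_le (by linarith) (le_abs_self _)
  have hneg : Tame (sgn p) {x | x ∈ J ∧ x < -z} := by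
    refine Tame.of_const (SignType.sign (ini m r p).leadingCoeff * (-1) ^ (ini m r p).natDegree) ?_
    rintro x ⟨hx, hzx⟩
    rw [hbig x hx, sign_neg (hzx.trans (neg_lt_zero.2 hz0))]
    intro hB
    have := ld_le_ld hB hzB.neg hzx.le
    rw [ld_neg, hzld] at this
    exact lt_of_lt_of_le (by linarith) (neg_le_abs _)
  refine Tame.glue (K₂ := {x | x ∈ J ∧ -z < x}) hneg ?_ (-z) (fun x hx h => ⟨hx, h⟩)
    (fun x hx h => ⟨hx, h⟩)
  refine Tame.glue hmid hpos z ?_ (fun x hx h => ⟨hx.1, h⟩)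
  intro x hx hxz
  have hB := hzB.of_abs_le hx.2.le hxz.le
  refine ⟨hB, abs_le.2 ⟨?_, ?_⟩⟩
  · have := ld_le_ld hzB.neg hB hx.2.le
    rw [ld_neg, hzld] at this
    push_cast
    exact this
  · have := ld_le_ld hB hzB hxz.le
    rw [hzld] at this
    push_cast
    exact this

/-- One passes to the next slope `r' < r` of the Newton polygon and translates by a root of the
initial form there. Either the multiplicity of the root is less than `d`, or the initial form is `u
(X - a) ^ d`. In the latter case `N * r'` is an integer, so the translate keeps the denominator `N`,
and the natural number bounding `N * r` drops. -/
theorem tame_near_zero (d : ℕ) : ∀ (p : FracPoly[X]) (m : ℚ) (r : ℚ≥0),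
    (∀ i : ℕ, Bdd (m - i * r) (p.coeff i)) → (ini m r p).coeff d ≠ 0 →
    ∃ ε > 0, Tame (sgn p) {x | Bdd r x ∧ |ld r x| < ε} := by
  induction d using Nat.strong_induction_on with
  | _ d ihd =>
  intro p m r
  obtain ⟨N, hN, hpN⟩ := exists_denom p
  obtain ⟨n, hn⟩ := exists_nat_ge ((N : ℚ) * r)
  induction n using Nat.strong_induction_on generalizing p m r with
  | _ n ihn =>
  intro hw hd
  -- Afterwards `d` is the exact order of vanishing of the initial form at 0.
  by_cases hlow : ∃ i < d, (ini m r p).coeff i ≠ 0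
  · obtain ⟨i, hi, hne⟩ := hlow
    exact ihd i hi p m r hw hne
  push Not at hlow
  obtain ⟨ε, hε, hsign⟩ := sign_eval_near_zero _ hd hlow
  refine ⟨ε, hε, ?_⟩
  set u : ℝ := (ini m r p).coeff d with hu
  have hcl : ∀ x, Bdd r x → |ld r x| < ε → (d ≠ 0 → ld r x ≠ 0) →
      sgn p x = SignType.sign u * SignType.sign (ld r x) ^ d := by
    intro x hx hlt hne
    have h1 := hsign _ hlt
    rw [sgn_eq_of_ini hw hx, h1]
    intro h
    rw [h, sign_zero, eq_comm, mul_eq_zero, sign_eq_zero_iff, pow_eq_zero_iff', sign_eq_zero_iff] at h1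
    rcases h1 with h1 | h1
    · exact hd h1
    · exact hne h1.2 h1.1
  rcases Nat.eq_zero_or_pos d with hd0 | hd0
  · refine Tame.of_const (SignType.sign u) fun x hx => ?_
    rw [hcl x hx.1 hx.2 (fun h => absurd hd0 h), hd0, pow_zero, mul_one]
  rcases eq_or_lt_of_le (zero_le (a := r)) with hr0 | hr0
  -- For `r = 0` the elements in question are constants, so no smaller exponents remain.
  · refine tame_of_signs (u := SignType.sign u) (d := d) fun x hx hx0 => ?_
    have hne : ld r x ≠ 0 := by
      have h1 := hx.1.dg_le hx0
      rw [← hr0] at h1 ⊢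
      have h2 : dg x = 0 := le_antisymm (NNRat.cast_le.1 h1) (zero_le)
      rw [← h2]
      exact ld_dg_ne hx0
    rw [hcl x hx.1 hx.2 fun _ => hne, sign_of_ld hx.1 hne]
  have hrq : (0 : ℚ) < r := NNRat.cast_pos.2 hr0
  obtain ⟨e, he⟩ : ∃ e : ℚ, e = m - d * r := ⟨_, rfl⟩
  have hue : u = ld e (p.coeff d) := by rw [hu, coeff_ini, he]
  have he0 : 0 ≤ e := by
    by_contra h
    have hB := hw d
    rw [← he] at hB
    rw [hue, hB.eq_zero (not_le.1 h), ld_zero] at hd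
    exact hd rfl
  -- The quotient is the weight of the variable at which the terms of index `i` and `d` balance. The
  -- largest one, cut off at 0, is the next slope `r'`.
  obtain ⟨i₀, hi₀, hmax⟩ := Finset.exists_max_image (Finset.range d)
    (fun i : ℕ => ((dg (p.coeff i) : ℚ) - e) / (d - i)) ⟨0, Finset.mem_range.2 hd0⟩
  rw [Finset.mem_range] at hi₀
  have hdi : ∀ i < d, (0 : ℚ) < (d : ℚ) - i := fun i hi => sub_pos.2 (by exact_mod_cast hi)
  obtain ⟨r', hr'⟩ : ∃ r' : ℚ≥0, (r' : ℚ) = max 0 (((dg (p.coeff i₀) : ℚ) - e) / (d - i₀)) :=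
    ⟨⟨_, le_max_left _ _⟩, rfl⟩
  have hr'r : (r' : ℚ) < r := by
    rw [hr', max_lt_iff]
    refine ⟨hrq, ?_⟩
    rw [div_lt_iff₀ (hdi _ hi₀)]
    have hmul := mul_pos hrq (hdi _ hi₀)
    by_cases hq : p.coeff i₀ = 0
    · rw [hq]
      have : dg (0 : FracPoly) = 0 := rfl
      rw [this, NNRat.cast_zero]
      linarith
    · have h1 := (hw i₀).dg_le hq
      have h2 : (dg (p.coeff i₀) : ℚ) ≠ m - i₀ * r := by
        intro h
        have := hlow i₀ hi₀
        rw [coeff_ini, ← h] at this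
        exact ld_dg_ne hq this
      have := lt_of_le_of_ne h1 h2
      have : m - i₀ * r = r * (d - i₀) + e := by rw [he]; ring
      linarith
  have hdgi : ∀ i < d, (dg (p.coeff i) : ℚ) ≤ e + (d - i) * r' := by
    intro i hi
    have h1 := (hmax i (Finset.mem_range.2 hi)).trans (le_max_right 0 _)
    rw [← hr', div_le_iff₀ (hdi _ hi)] at h1
    linarith
  have hw' : ∀ s : ℚ, r' ≤ s → s ≤ r → ∀ i : ℕ, Bdd (e + d * s - i * s) (p.coeff i) := by
    intro s hs hsr i
    rcases lt_or_ge i d with hi | hi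
    · refine (bdd_dg _).mono ((hdgi i hi).trans ?_)
      have := mul_le_mul_of_nonneg_left hs (hdi i hi).le
      linarith
    · refine (hw i).mono ?_
      have hi' : (0 : ℚ) ≤ (i : ℚ) - d := sub_nonneg.2 (by exact_mod_cast hi)
      have := mul_le_mul_of_nonneg_left hsr hi'
      rw [he]
      linarith
  have hcoef_gt : ∀ s : ℚ, r' ≤ s → s < r → ∀ i, d < i → (ini (e + d * s) s p).coeff i = 0 := by
    intro s hs hsr i hi
    rw [coeff_ini]
    refine (hw i).ld_eq_zero ?_
    have hi' : (0 : ℚ) < (i : ℚ) - d := sub_pos.2 (by exact_mod_cast hi)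
    have := mul_lt_mul_of_pos_left hsr hi'
    rw [he]
    linarith
  have hcoef_d : ∀ s : ℚ, (ini (e + d * s) s p).coeff d = u := by
    intro s
    rw [coeff_ini, hue]
    congr 1
    ring
  -- Strictly between two slopes the term of index `d` dominates alone.
  have hini_between : ∀ s : ℚ, r' < s → s < r → ini (e + d * s) s p = C u * X ^ d := by
    intro s hs hsr
    ext i
    rw [coeff_C_mul_X_pow]
    rcases lt_trichotomy i d with hi | rfl | hi
    · rw [if_neg hi.ne, coeff_ini]
      refine (bdd_dg _).ld_eq_zero ((hdgi i hi).trans_lt ?_)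
      have := mul_lt_mul_of_pos_left hs (hdi i hi)
      linarith
    · rw [if_pos rfl, hcoef_d]
    · rw [if_neg hi.ne', hcoef_gt s hs.le hsr i hi]
  obtain ⟨φ, hφ⟩ : ∃ φ, φ = ini (e + d * r') r' p := ⟨_, rfl⟩
  have hφd : φ.coeff d = u := by rw [hφ, hcoef_d]
  have hφdeg : φ.natDegree = d := by
    refine le_antisymm (natDegree_le_iff_coeff_eq_zero.2 fun i hi => ?_)
      (le_natDegree_of_ne_zero (by rwa [hφd]))
    rw [hφ, hcoef_gt r' le_rfl hr'r i hi]
  have hφlead : φ.leadingCoeff = u := by rw [leadingCoeff, hφdeg, hφd]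
  have hφ0 : φ ≠ 0 := by
    intro h
    rw [h, coeff_zero] at hφd
    exact hd hφd.symm
  have hwr := hw' r' le_rfl hr'r.le
  refine tame_of_outer hwr (by rwa [← hφ]) ?_ ?_
  · rintro x ⟨hxB, hxε⟩ hxr'
    rw [← hφ, hφlead, hφdeg]
    have hx0 : x ≠ 0 := by rintro rfl; exact hxr' (bdd_zero _)
    have hs1 : (r' : ℚ) < dg x := by
      by_contra h
      exact hxr' ((bdd_dg x).mono (not_lt.1 h))
    have hne := ld_dg_ne hx0
    rcases eq_or_lt_of_le (hxB.dg_le hx0) with hs2 | hs2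
    · rw [hs2] at hne
      rw [hcl x hxB hxε fun _ => hne, sign_of_ld hxB hne]
    · have h1 := hini_between _ hs1 hs2
      have h2 : (ini (e + d * dg x) (dg x) p).eval (ld (dg x) x) = u * ld (dg x) x ^ d := by
        rw [h1]; simp
      rw [sgn_eq_of_ini (hw' _ hs1.le hs2.le) (bdd_dg x), h2, sign_mul, sign_pow,
        sign_of_ld (bdd_dg x) hne]
      rw [h2]
      exact mul_ne_zero hd (pow_ne_zero _ hne)
  · intro c
    by_cases hc : φ.eval c = 0
    swap
    · rw [hφ] at hc
      exact tame_of_ini_ne hwr hc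
    rw [hφ] at hc
    obtain ⟨a, rfl⟩ := exists_realAlg_of_root (by rwa [← hφ]) hc
    obtain ⟨b, hb⟩ : ∃ b : FracPoly, b = AddMonoidAlgebra.single r' a := ⟨_, rfl⟩
    have hbB : Bdd r' b := by rw [hb]; exact bdd_single r' a
    have hbl : ld r' b = a := by rw [hb]; exact ld_single r' a
    have hwt := bdd_taylor hwr hbB
    have hit := ini_taylor hwr hbB
    rw [← hφ, hbl] at hit
    have htd : (taylor (a : ℝ) φ).coeff d = u := by
      have := coeff_taylor_natDegree (f := φ) (r := (a : ℝ))
      rw [hφdeg] at this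
      rw [this, hφlead]
    have hgoal : (∃ ε > 0, Tame (sgn (taylor b p)) {x | Bdd r' x ∧ |ld r' x| < ε}) →
        ∃ ε > 0, Tame (sgn p) {x | Bdd r' x ∧ |ld r' x - a| < ε} := by
      rintro ⟨δ, hδ, hT⟩
      have := tame_of_taylor hbB hT
      rw [hbl] at this
      exact ⟨δ, hδ, this⟩
    apply hgoal
    by_cases hlow' : ∃ i < d, (taylor (a : ℝ) φ).coeff i ≠ 0
    · obtain ⟨i, hi, hne⟩ := hlow'
      exact ihd i hi _ _ r' hwt (by rwa [hit])
    push Not at hlow'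
    -- The remaining case is a root of full multiplicity `d`.
    obtain ⟨k, hk⟩ : ∃ k : ℕ, (N : ℚ≥0) * r' = k := by
      rcases eq_or_lt_of_le (zero_le (a := r')) with h0 | h0
      · exact ⟨0, by rw [← h0]; simp⟩
      have hr'2 : (r' : ℚ) = ((dg (p.coeff i₀) : ℚ) - e) / (d - i₀) := by
        have h1 : (0 : ℚ) < r' := NNRat.cast_pos.2 h0
        rcases max_choice 0 (((dg (p.coeff i₀) : ℚ) - e) / (d - i₀)) with h | h
        · rw [hr', h] at h1
          exact absurd h1 (lt_irrefl _)
        · rw [hr', h]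
      have hφi₀ : φ.coeff i₀ ≠ 0 := by
        have h1 : e + d * r' - i₀ * r' = dg (p.coeff i₀) := by
          have : (r' : ℚ) * (d - i₀) = (dg (p.coeff i₀) : ℚ) - e := by
            rw [hr'2, div_mul_cancel₀ _ (hdi _ hi₀).ne']
          linarith
        rw [hφ, coeff_ini, h1]
        refine ld_dg_ne fun h => ?_
        have : (r' : ℚ) ≤ 0 := by
          rw [hr'2, h]
          refine div_nonpos_of_nonpos_of_nonneg ?_ (hdi _ hi₀).le
          have : dg (0 : FracPoly) = 0 := rfl
          rw [this, NNRat.cast_zero]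
          linarith
        exact absurd (NNRat.cast_pos.2 h0) (not_lt.2 this)
      have hpow : φ = C u * (X - C (a : ℝ)) ^ d := by
        have h1 : taylor (a : ℝ) φ = C u * X ^ d := by
          ext i
          rw [coeff_C_mul_X_pow]
          rcases lt_trichotomy i d with hi | rfl | hi
          · rw [if_neg hi.ne, hlow' i hi]
          · rw [if_pos rfl, htd]
          · rw [if_neg hi.ne', coeff_eq_zero_of_natDegree_lt]
            rwa [natDegree_taylor, hφdeg]
        have h2 : taylor (-(a : ℝ)) (taylor (a : ℝ) φ) = φ := by
          rw [taylor_taylor]; simp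
        rw [← h2, h1, taylor_mul, taylor_C, taylor_pow, taylor_X, C_neg, sub_eq_add_neg]
      have ha0 : (a : ℝ) ≠ 0 := by
        intro ha0
        rw [hpow, ha0, C_0, sub_zero, coeff_C_mul_X_pow, if_neg hi₀.ne] at hφi₀
        exact hφi₀ rfl
      -- Comparing the terms of consecutive indices `d - 1` and `d` exhibits `r'` as a difference of
      -- two exponents occurring in `p`, without dividing by an index gap.
      have hsub : φ.coeff (d - 1) ≠ 0 := by
        rw [hpow, coeff_C_mul, sub_eq_add_neg, ← C_neg, coeff_X_add_C_pow,
          show d - (d - 1) = 1 by omega]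
        have : d.choose (d - 1) ≠ 0 := (Nat.choose_pos (by omega)).ne'
        have h3 : (d.choose (d - 1) : ℝ) ≠ 0 := by exact_mod_cast this
        exact mul_ne_zero hd (mul_ne_zero (by simpa using ha0) h3)
      have hexp : ∀ (i : ℕ) (s : ℚ), ld s (p.coeff i) ≠ 0 → ∃ k : ℕ, (N : ℚ) * s = k := by
        intro i s hs
        rw [ld] at hs
        split_ifs at hs with h
        · obtain ⟨k, hk⟩ := hpN i ⟨s, h⟩ (by simpa using hs)
          have := congrArg (NNRat.cast : ℚ≥0 → ℚ) hk
          push_cast at this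
          exact ⟨k, this⟩
        · exact absurd rfl hs
      rw [hφ, coeff_ini] at hsub
      obtain ⟨k₁, hk₁⟩ := hexp _ _ hsub
      obtain ⟨k₂, hk₂⟩ := hexp d e (by rwa [← hue])
      have hcast : ((d - 1 : ℕ) : ℚ) = d - 1 := by
        rw [Nat.cast_sub hd0]; simp
      have hkk : (N : ℚ) * r' = (k₁ : ℚ) - k₂ := by
        rw [← hk₁, ← hk₂, hcast]; ring
      have hle : k₂ ≤ k₁ := by
        have h1 : (0 : ℚ) ≤ N * r' := by positivity
        rw [hkk, sub_nonneg] at h1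
        exact_mod_cast h1
      refine ⟨k₁ - k₂, ?_⟩
      have : (((N : ℚ≥0) * r' : ℚ≥0) : ℚ) = (((k₁ - k₂ : ℕ) : ℚ≥0) : ℚ) := by
        rw [NNRat.cast_natCast, Nat.cast_sub hle, ← hkk, NNRat.cast_mul, NNRat.cast_natCast]
      exact_mod_cast this
    have hkq : (N : ℚ) * r' = k := by
      have := congrArg (NNRat.cast : ℚ≥0 → ℚ) hk
      push_cast at this
      exact this
    have hkn : k < n := by
      have h1 : (N : ℚ) * r' < N * r := mul_lt_mul_of_pos_left hr'r (by exact_mod_cast hN)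
      have h2 : (k : ℚ) < n := by linarith
      exact_mod_cast h2
    refine ihn k hkn _ _ r' (taylor_coeff_mem hpN ?_) hkq.le hwt ?_
    · rw [hb]
      exact single_mem_denomSubring hk a
    · rw [hit, htd]
      exact hd

/-- For a weight `k` above the degrees of all coefficients the leading term dominates, so the
initial form is `u X ^ n`, whose only possible root is 0. -/
theorem tame_sgn (p : FracPoly[X]) : Tame (sgn p) Set.univ := by
  by_cases hp : p = 0
  · exact Tame.of_const 0 fun x _ => by simp [sgn, hp]
  obtain ⟨n, hn⟩ : ∃ n, n = p.natDegree := ⟨_, rfl⟩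
  obtain ⟨e, he⟩ : ∃ e : ℚ, e = dg p.leadingCoeff := ⟨_, rfl⟩
  obtain ⟨u, hu⟩ : ∃ u, u = ld e p.leadingCoeff := ⟨_, rfl⟩
  have hu0 : u ≠ 0 := by
    rw [hu, he]
    exact ld_dg_ne (leadingCoeff_ne_zero.2 hp)
  have he0 : 0 ≤ e := by rw [he]; positivity
  obtain ⟨k, hk⟩ : ∃ k : ℕ, ∀ i, (dg (p.coeff i) : ℚ) < k := by
    obtain ⟨k, hk⟩ := exists_nat_gt ((Finset.range (n + 1)).sup fun i => dg (p.coeff i))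
    refine ⟨k, fun i => ?_⟩
    have hle : dg (p.coeff i) ≤ (Finset.range (n + 1)).sup fun i => dg (p.coeff i) := by
      by_cases hi : i < n + 1
      · exact Finset.le_sup (f := fun i => dg (p.coeff i)) (Finset.mem_range.2 hi)
      · rw [coeff_eq_zero_of_natDegree_lt (by omega)]
        exact zero_le
    exact_mod_cast hle.trans_lt hk
  have hk0 : (0 : ℚ) < k := lt_of_le_of_lt (by positivity) (hk 0)
  have hlt : ∀ s : ℚ, k ≤ s → ∀ i < n, (dg (p.coeff i) : ℚ) < e + n * s - i * s := by
    intro s hs i hi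
    have h1 : (1 : ℚ) ≤ (n : ℚ) - i := by
      have : (i : ℚ) + 1 ≤ n := by exact_mod_cast hi
      linarith
    have h2 : s ≤ (n - i) * s := le_mul_of_one_le_left (hk0.le.trans hs) h1
    linarith [hk i]
  have hw : ∀ s : ℚ, k ≤ s → ∀ i : ℕ, Bdd (e + n * s - i * s) (p.coeff i) := by
    intro s hs i
    rcases lt_trichotomy i n with hi | hi | hi
    · exact (bdd_dg _).mono (hlt s hs i hi).le
    · rw [hi, add_sub_cancel_right, hn, he]
      exact bdd_dg _
    · rw [coeff_eq_zero_of_natDegree_lt (by omega)]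
      exact bdd_zero _
  have hini : ∀ s : ℚ, k ≤ s → ini (e + n * s) s p = C u * X ^ n := by
    intro s hs
    ext i
    rw [coeff_C_mul_X_pow, coeff_ini]
    rcases lt_trichotomy i n with hi | hi | hi
    · rw [if_neg hi.ne]
      exact (bdd_dg _).ld_eq_zero (hlt s hs i hi)
    · rw [if_pos hi, hi, add_sub_cancel_right, hu, hn]
      rfl
    · rw [if_neg hi.ne', coeff_eq_zero_of_natDegree_lt (by omega), ld_zero]
  have hcast : (((k : ℚ≥0)) : ℚ) = k := by push_cast; rfl
  have hwk : ∀ i : ℕ, Bdd (e + n * (k : ℚ≥0) - i * (k : ℚ≥0)) (p.coeff i) := by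
    rw [hcast]
    exact hw k le_rfl
  have hik : ini (e + n * (k : ℚ≥0)) (k : ℚ≥0) p = C u * X ^ n := by
    rw [hcast]
    exact hini k le_rfl
  refine tame_of_outer (r := k) hwk ?_ ?_ ?_
  · rw [hik]
    exact mul_ne_zero (C_ne_zero.2 hu0) (pow_ne_zero _ X_ne_zero)
  · intro x _ hx
    rw [hik, leadingCoeff_C_mul_X_pow, natDegree_C_mul_X_pow _ _ hu0]
    have hx0 : x ≠ 0 := by rintro rfl; exact hx (bdd_zero _)
    have hs : (k : ℚ) ≤ dg x := by
      by_contra h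
      exact hx ((bdd_dg x).mono (by rw [hcast]; exact (not_le.1 h).le))
    have hne := ld_dg_ne hx0
    have h2 : (ini (e + n * dg x) (dg x) p).eval (ld (dg x) x) = u * ld (dg x) x ^ n := by
      rw [hini _ hs]; simp
    rw [sgn_eq_of_ini (hw _ hs) (bdd_dg x), h2, sign_mul, sign_pow, sign_of_ld (bdd_dg x) hne]
    rw [h2]
    exact mul_ne_zero hu0 (pow_ne_zero _ hne)
  · intro c
    by_cases hc : c = 0
    · obtain ⟨ε, hε, h⟩ := tame_near_zero n p _ k hwk (by rw [hik]; simpa using hu0)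
      exact ⟨ε, hε, by simpa [hc] using h⟩
    · refine tame_of_ini_ne hwk ?_
      rw [hik]
      simpa using ⟨hu0, fun h => absurd h hc⟩

/-! ### Arithmetic of Shepherdson's model -/

theorem mem_shepherdson {P : FracPoly} :
    P ∈ shepherdson ↔ 0 ≤ P ∧ ∃ k : ℤ, P.coeff 0 = (k : RealAlg) := by
  rw [← nonneg_iff_le]
  rfl

theorem Shepherdson.nonneg (x : Shepherdson) : (0 : FracPoly) ≤ x := (mem_shepherdson.1 x.2).1

theorem Shepherdson.exists_int (x : Shepherdson) :
    ∃ k : ℤ, (x : FracPoly).coeff 0 = (k : RealAlg) := (mem_shepherdson.1 x.2).2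

theorem coeff_zero_one : (1 : FracPoly).coeff 0 = 1 := by
  simp [AddMonoidAlgebra.one_def]

/-- A positive element of positive degree exceeds every constant; one of degree 0 is a positive
integer. -/
theorem one_le_of_pos {f : FracPoly} (hf : 0 < f) (h : ∃ k : ℤ, f.coeff 0 = (k : RealAlg)) :
    1 ≤ f := by
  obtain ⟨k, hk⟩ := h
  have hpos : 0 < ld (dg f) f :=
    lt_of_le_of_ne ((nonneg_iff f).1 ((nonneg_iff_le f).2 hf.le)) (ld_dg_ne hf.ne').symm
  rcases eq_or_lt_of_le (zero_le (a := dg f)) with h0 | h0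
  · have hB := bdd_dg f
    rw [← h0] at hB
    rw [← h0, ld_coe, hk] at hpos
    have hk1 : (1 : ℤ) ≤ k := by
      have : (0 : ℝ) < k := by simpa using hpos
      exact_mod_cast this
    obtain ⟨j, rfl⟩ := Int.eq_ofNat_of_zero_le (by omega : 0 ≤ k)
    have hf1 : f = (j : FracPoly) := by
      rw [← AddMonoidAlgebra.coeff_inj]
      ext t
      rcases eq_or_lt_of_le (zero_le (a := t)) with ht | ht
      · rw [← ht, hk, AddMonoidAlgebra.coeff_natCast]
        simp
      · rw [hB t (NNRat.cast_lt.2 ht), AddMonoidAlgebra.coeff_natCast,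
          Finsupp.single_eq_of_ne ht.ne']
    rw [hf1]
    exact_mod_cast hk1
  · have h1 : (0 : ℚ) < dg f := NNRat.cast_pos.2 h0
    refine le_of_lt (sub_pos.1 (pos_of_ld ((bdd_dg f).sub (bdd_one.mono h1.le)) ?_))
    rwa [ld_sub, bdd_one.ld_eq_zero h1, sub_zero]

theorem sub_mem_shepherdson {x y : FracPoly} (hx : x ∈ shepherdson) (hy : y ∈ shepherdson)
    (h : x ≤ y) : y - x ∈ shepherdson := by
  obtain ⟨k, hk⟩ := (mem_shepherdson.1 hx).2
  obtain ⟨l, hl⟩ := (mem_shepherdson.1 hy).2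
  exact mem_shepherdson.2 ⟨sub_nonneg.2 h, l - k, by simp [hk, hl]⟩

theorem Shepherdson.add_one_le {x y : Shepherdson} (h : (x : FracPoly) < y) :
    (x : FracPoly) + 1 ≤ y := by
  have := one_le_of_pos (sub_pos.2 h) (mem_shepherdson.1 (sub_mem_shepherdson x.2 y.2 h.le)).2
  linarith

/-- Subtract the fractional part of the constant coefficient. -/
theorem exists_floor {c : FracPoly} (hc : 0 ≤ c) :
    ∃ d : Shepherdson, (d : FracPoly) ≤ c ∧ ∀ x : Shepherdson, (x : FracPoly) ≤ c →
      (x : FracPoly) ≤ d := by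
  obtain ⟨k, hk⟩ : ∃ k : ℤ, k = ⌊((c.coeff 0 : RealAlg) : ℝ)⌋ := ⟨_, rfl⟩
  obtain ⟨a, ha⟩ : ∃ a : RealAlg, a = c.coeff 0 - k := ⟨_, rfl⟩
  have har : (a : ℝ) = (c.coeff 0 : ℝ) - k := by rw [ha]; simp
  have ha0 : 0 ≤ (a : ℝ) := by
    rw [har, hk]; linarith [Int.floor_le ((c.coeff 0 : RealAlg) : ℝ)]
  have ha1 : (a : ℝ) < 1 := by
    rw [har, hk]; linarith [Int.lt_floor_add_one ((c.coeff 0 : RealAlg) : ℝ)]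
  obtain ⟨b, hb⟩ : ∃ b : FracPoly, b = AddMonoidAlgebra.single 0 a := ⟨_, rfl⟩
  have hbB : Bdd 0 b := by
    have := bdd_single 0 a
    rwa [NNRat.cast_zero, ← hb] at this
  have hbl : ld 0 b = a := by
    have := ld_single 0 a
    rwa [NNRat.cast_zero, ← hb] at this
  have hb0 : 0 ≤ b := by
    rcases eq_or_lt_of_le ha0 with h | h
    · have : a = 0 := Subtype.ext h.symm
      rw [hb, this]
      simp
    · exact (pos_of_ld hbB (by rwa [hbl])).le
  have hb1 : b < 1 := sub_pos.1 (pos_of_ld (bdd_one.sub hbB) (by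
    rw [ld_sub, hbl, ld_one]; linarith))
  have hint : ∃ l : ℤ, (c - b).coeff 0 = (l : RealAlg) := ⟨k, by simp [hb, ha]⟩
  -- Otherwise `c - b ≤ -1` by discreteness, and `b < 1` would make `c` negative.
  have hd0 : 0 ≤ c - b := by
    by_contra h
    have h1 : 0 < -(c - b) := by linarith [not_le.1 h]
    have := one_le_of_pos h1 (by
      obtain ⟨l, hl⟩ := hint
      exact ⟨-l, by rw [AddMonoidAlgebra.coeff_neg, Finsupp.neg_apply, hl]; push_cast; rfl⟩)
    linarith
  refine ⟨⟨c - b, mem_shepherdson.2 ⟨hd0, hint⟩⟩, by simpa using hb0, fun x hx => ?_⟩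
  by_contra h
  have h1 := Shepherdson.add_one_le (x := ⟨c - b, mem_shepherdson.2 ⟨hd0, hint⟩⟩) (not_le.1 h)
  dsimp only at h1
  linarith

/-- The truth value of the predicate changes only across finitely many cut points. -/
def TamePred (P : Shepherdson → Prop) : Prop :=
  ∃ C : Finset FracPoly, ∀ x y : Shepherdson, (x : FracPoly) < y →
    (∀ c ∈ C, ¬ ((x : FracPoly) ≤ c ∧ c ≤ y)) → (P x ↔ P y)

theorem TamePred.imp {P Q : Shepherdson → Prop} (hP : TamePred P) (hQ : TamePred Q) :
    TamePred fun x => P x → Q x := by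
  classical
  obtain ⟨C, hC⟩ := hP
  obtain ⟨D, hD⟩ := hQ
  refine ⟨C ∪ D, fun x y hxy h => ?_⟩
  dsimp only
  rw [hC x y hxy fun c hc => h c (by simp [hc]), hD x y hxy fun c hc => h c (by simp [hc])]

theorem tamePred_sgn (p : FracPoly[X]) (Q : SignType → Prop) :
    TamePred fun x : Shepherdson => Q (sgn p x) := by
  obtain ⟨C, hC⟩ := tame_sgn p
  exact ⟨C, fun x y hxy h => by dsimp only; rw [hC x trivial y trivial hxy h]⟩

/-- Induction on the number of cut points, taken in the model. A cut point `d` in the interval is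
approached up to `d - 1`, crossed by the two successor steps to `d` and `d + 1`, and does not matter
on either remaining interval. -/
theorem TamePred.forall_of_succ {P : Shepherdson → Prop} (hP : TamePred P) (h0 : P 0)
    (hs : ∀ x, P x → P (x + 1)) (b : Shepherdson) : P b := by
  classical
  have key : ∀ D : Finset Shepherdson, ∀ a b : Shepherdson, (a : FracPoly) ≤ b → P a →
      (∀ x y : Shepherdson, (a : FracPoly) ≤ x → (x : FracPoly) < y → (y : FracPoly) ≤ b →
        (∀ d ∈ D, ¬ ((x : FracPoly) ≤ d ∧ (d : FracPoly) ≤ y)) → (P x ↔ P y)) → P b := by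
    intro D
    induction D using Finset.induction_on with
    | empty =>
      intro a b hab ha h
      rcases eq_or_lt_of_le hab with h1 | h1
      · rwa [← Subtype.ext h1]
      · exact (h a b le_rfl h1 le_rfl (by simp)).1 ha
    | insert d D _ ih =>
      intro a b hab ha h
      by_cases hd : (a : FracPoly) ≤ d ∧ (d : FracPoly) ≤ b
      swap
      · refine ih a b hab ha fun x y hax hxy hyb hD => h x y hax hxy hyb fun c hc => ?_
        rcases Finset.mem_insert.1 hc with rfl | hc
        · exact fun h' => hd ⟨hax.trans h'.1, h'.2.trans hyb⟩
        · exact hD c hc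
      obtain ⟨had, hdb⟩ := hd
      have hPd : P d := by
        rcases eq_or_lt_of_le had with h1 | h1
        · rwa [← Subtype.ext h1]
        have h2 := Shepherdson.add_one_le h1
        have h3 : (1 : FracPoly) ≤ d := by linarith [a.nonneg]
        obtain ⟨e, he⟩ : ∃ e : Shepherdson, (e : FracPoly) = d - 1 :=
          ⟨⟨_, sub_mem_shepherdson (one_mem _) d.2 h3⟩, rfl⟩
        have hed : e + 1 = d := Subtype.ext (by push_cast; rw [he]; ring)
        rw [← hed]
        refine hs e (ih a e (by rw [he]; linarith) ha fun x y hax hxy hye hD =>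
          h x y hax hxy (by linarith) fun c hc => ?_)
        rcases Finset.mem_insert.1 hc with rfl | hc
        · exact fun h' => by linarith [h'.2]
        · exact hD c hc
      rcases eq_or_lt_of_le hdb with h1 | h1
      · rwa [← Subtype.ext h1]
      have h2 := Shepherdson.add_one_le h1
      refine ih (d + 1) b (by push_cast; exact h2) (hs d hPd) fun x y hdx hxy hyb hD =>
          h x y ?_ hxy hyb fun c hc => ?_
      · push_cast at hdx
        linarith
      · push_cast at hdx
        rcases Finset.mem_insert.1 hc with rfl | hc
        · exact fun h' => by linarith [h'.1]
        · exact hD c hc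
  obtain ⟨C, hC⟩ := hP
  -- Negative cut points separate no elements of the model, so their value 0 is arbitrary.
  have hfl : ∀ c : FracPoly, ∃ d : Shepherdson, 0 ≤ c → (d : FracPoly) ≤ c ∧
      ∀ x : Shepherdson, (x : FracPoly) ≤ c → (x : FracPoly) ≤ d := by
    intro c
    by_cases hc : 0 ≤ c
    · obtain ⟨d, hd⟩ := exists_floor hc
      exact ⟨d, fun _ => hd⟩
    · exact ⟨0, fun h => absurd h hc⟩
  choose fl hfl using hfl
  refine key (C.image fl) 0 b b.nonneg h0 fun x y _ hxy _ hD => hC x y hxy fun c hc h' => ?_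
  obtain ⟨h1, h2⟩ := hfl c (x.nonneg.trans h'.1)
  exact hD _ (Finset.mem_image_of_mem _ hc) ⟨h2 x h'.1, h1.trans h'.2⟩

/-! ### Terms and formulas in Shepherdson's model -/

section Realize

variable {α : Type} (v : α → Shepherdson)

theorem realize_zero : (0 : arith.Term α).realize v = 0 := rfl

theorem realize_one : (1 : arith.Term α).realize v = 1 := rfl

theorem realize_add (s t : arith.Term α) : (s + t).realize v = s.realize v + t.realize v := rfl

theorem realize_mul (s t : arith.Term α) : (s * t).realize v = s.realize v * t.realize v := rfl

variable {n : ℕ} (w : Empty → Shepherdson) (xs : Fin n → Shepherdson)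

theorem realize_two : (two : Tm n).realize (Sum.elim w xs) = 2 := one_add_one_eq_two

theorem realize_three : (three : Tm n).realize (Sum.elim w xs) = 3 := by
  rw [three, realize_add, realize_two, realize_one]
  exact two_add_one_eq_three

theorem realize_up (t : Tm n) (a : Shepherdson) :
    (up t).realize (Sum.elim w (Fin.snoc xs a)) = t.realize (Sum.elim w xs) := by
  rw [up, Term.realize_relabel]
  congr 1
  ext (i | i)
  · rfl
  · simp

theorem realize_new (a : Shepherdson) :
    (new : Tm (n + 1)).realize (Sum.elim w (Fin.snoc xs a)) = a := by
  simp [new]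

theorem realize_le (s t : Tm n) : (le s t).Realize w xs ↔
    ((s.realize (Sum.elim w xs) : Shepherdson) : FracPoly) ≤ (t.realize (Sum.elim w xs) : Shepherdson) :=
  Iff.rfl

theorem realize_lt (s t : Tm n) : (lt s t).Realize w xs ↔
    ((s.realize (Sum.elim w xs) : Shepherdson) : FracPoly) < (t.realize (Sum.elim w xs) : Shepherdson) := by
  rw [lt, BoundedFormula.realize_inf, realize_le, BoundedFormula.realize_not,
    BoundedFormula.realize_bdEqual, lt_iff_le_and_ne, Ne, Subtype.ext_iff]

theorem realize_dvd (s t : Tm n) : (dvd s t).Realize w xs ↔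
    s.realize (Sum.elim w xs) ∣ t.realize (Sum.elim w xs) := by
  simp only [dvd, BoundedFormula.realize_ex, BoundedFormula.realize_bdEqual, realize_mul,
    realize_up, realize_new]
  exact ⟨fun ⟨a, ha⟩ => ⟨a, by rw [← ha, mul_comm]⟩, fun ⟨a, ha⟩ => ⟨a, by rw [ha, mul_comm]⟩⟩

theorem realize_pow2 (t : Tm n) : (pow2 t).Realize w xs ↔
    ∀ y : Shepherdson, y ∣ t.realize (Sum.elim w xs) → y = 1 ∨ 2 ∣ y := by
  simp only [pow2, BoundedFormula.realize_all, BoundedFormula.realize_imp,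
    BoundedFormula.realize_sup, BoundedFormula.realize_bdEqual, realize_dvd, realize_up,
    realize_new, realize_one, realize_two]

theorem realize_pow2Tar (t : Tm n) : (pow2Tar t).Realize w xs ↔
    ∀ y z : Shepherdson, t.realize (Sum.elim w xs) ≠ (2 * y + 3) * z := by
  simp only [pow2Tar, BoundedFormula.realize_all, BoundedFormula.realize_not,
    BoundedFormula.realize_bdEqual, realize_mul, realize_add, realize_up, realize_new,
    realize_two, realize_three, Ne]

end Realize

theorem isPow2_iff (a : Shepherdson) :
    IsPow2 a ↔ ∀ y : Shepherdson, y ∣ a → y = 1 ∨ 2 ∣ y :=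
  realize_pow2 _ _ _

theorem isPow2Tar_iff (a : Shepherdson) :
    IsPow2Tar a ↔ ∀ y z : Shepherdson, a ≠ (2 * y + 3) * z :=
  realize_pow2Tar _ _ _

theorem exists_polynomial_of_term {α : Type} (w : Shepherdson → α → Shepherdson)
    (hw : ∀ a, ∃ p : FracPoly[X], ∀ x, (w x a : FracPoly) = p.eval (x : FracPoly))
    (t : arith.Term α) :
    ∃ p : FracPoly[X], ∀ x, ((t.realize (w x) : Shepherdson) : FracPoly) = p.eval (x : FracPoly) := by
  induction t with
  | var a => exact hw a
  | func f ts ih =>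
    change ArithFunc _ at f
    cases f with
    | zero => exact ⟨0, fun x => by rw [eval_zero]; rfl⟩
    | one => exact ⟨1, fun x => by rw [eval_one]; rfl⟩
    | add =>
      obtain ⟨p, hp⟩ := ih 0
      obtain ⟨q, hq⟩ := ih 1
      exact ⟨p + q, fun x => by rw [eval_add, ← hp, ← hq]; rfl⟩
    | mul =>
      obtain ⟨p, hp⟩ := ih 0
      obtain ⟨q, hq⟩ := ih 1
      exact ⟨p * q, fun x => by rw [eval_mul, ← hp, ← hq]; rfl⟩

theorem tamePred_of_isAtomic {α : Type} {n : ℕ} (w : Shepherdson → α → Shepherdson)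
    (hw : ∀ a, ∃ p : FracPoly[X], ∀ x, (w x a : FracPoly) = p.eval (x : FracPoly))
    (xs : Fin n → Shepherdson) {φ : arith.BoundedFormula α n} (hφ : φ.IsAtomic) :
    TamePred fun x => φ.Realize (w x) xs := by
  have hw' : ∀ a : α ⊕ Fin n, ∃ p : FracPoly[X], ∀ x,
      ((Sum.elim (w x) xs a : Shepherdson) : FracPoly) = p.eval (x : FracPoly) := by
    rintro (a | i)
    · exact hw a
    · exact ⟨C (xs i : FracPoly), fun x => by rw [eval_C]; rfl⟩
  have ht := exists_polynomial_of_term (fun x => Sum.elim (w x) xs) hw'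
  cases hφ with
  | equal t₁ t₂ =>
    obtain ⟨p, hp⟩ := ht t₁
    obtain ⟨q, hq⟩ := ht t₂
    convert tamePred_sgn (p - q) (fun s => s = 0) using 2 with x
    rw [BoundedFormula.realize_bdEqual, Subtype.ext_iff, hp, hq, sgn, sign_eq_zero_iff, eval_sub,
      sub_eq_zero]
  | rel R ts =>
    change ArithRel _ at R
    cases R with
    | le =>
      obtain ⟨p, hp⟩ := ht (ts 0)
      obtain ⟨q, hq⟩ := ht (ts 1)
      convert tamePred_sgn (q - p) (fun s => 0 ≤ s) using 2 with x
      rw [sgn, sign_nonneg_iff, eval_sub, sub_nonneg, ← hp, ← hq]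
      rfl

theorem tamePred_of_isQF {α : Type} {n : ℕ} (w : Shepherdson → α → Shepherdson)
    (hw : ∀ a, ∃ p : FracPoly[X], ∀ x, (w x a : FracPoly) = p.eval (x : FracPoly))
    (xs : Fin n → Shepherdson) {φ : arith.BoundedFormula α n} (hφ : φ.IsQF) :
    TamePred fun x => φ.Realize (w x) xs := by
  induction hφ with
  | falsum => exact ⟨∅, fun x y _ _ => Iff.rfl⟩
  | of_isAtomic h => exact tamePred_of_isAtomic w hw xs h
  | imp _ _ h1 h2 => exact h1.imp h2

theorem realize_induction {k : ℕ} {φ : arith.Formula (Fin k ⊕ Unit)} (hφ : φ.IsQF) :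
    Shepherdson ⊨ induction φ := by
  rw [Sentence.Realize, induction, Formula.realize_iAlls]
  intro v
  have hv : (fun a => Sum.elim (default : Empty → Shepherdson) v a) ∘ (Sum.inr : Fin k → _) = v :=
    rfl
  rw [Formula.realize_relabel, hv, Formula.realize_imp, Formula.realize_inf,
    Formula.realize_iAlls, Formula.realize_iAlls]
  rintro ⟨h0, hs⟩ b
  have hw : ∀ a, ∃ p : FracPoly[X], ∀ x : Shepherdson,
      ((Sum.elim v (fun _ => x) : Fin k ⊕ Unit → Shepherdson) a : FracPoly) =
        p.eval (x : FracPoly) := by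
    rintro (i | _)
    · exact ⟨C (v i : FracPoly), fun x => by rw [eval_C]; rfl⟩
    · exact ⟨X, fun x => by rw [eval_X]; rfl⟩
  have hT := tamePred_of_isQF (fun x => Sum.elim v fun _ => x) hw default hφ
  refine hT.forall_of_succ ?_ ?_ (b ())
  · rw [Formula.Realize, BoundedFormula.realize_subst] at h0
    convert h0 using 2 with a
    rcases a with i | _ <;> rfl
  · intro x hx
    have := hs fun _ => x
    rw [Formula.realize_imp] at this
    have := this hx
    rw [Formula.Realize, BoundedFormula.realize_subst] at this
    convert this using 2 with a
    rcases a with i | _ <;> rfl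

theorem models_PAjer : Shepherdson ⊨ PAjer := by
  rw [Theory.model_iff]
  intro σ hσ
  simp only [PAjer, Set.mem_insert_iff, Set.mem_singleton_iff] at hσ
  rcases hσ with rfl | rfl | rfl | rfl | rfl | rfl | rfl | rfl | rfl | rfl | rfl | rfl | rfl <;>
    simp only [Sentence.Realize, Formula.Realize, BoundedFormula.realize_all,
      BoundedFormula.realize_imp, BoundedFormula.realize_sup, BoundedFormula.realize_inf,
      BoundedFormula.realize_not, BoundedFormula.realize_bdEqual, realize_le, realize_add,
      realize_mul, realize_zero, realize_one]
  · exact fun x => add_zero x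
  · exact fun x y => add_comm x y
  · exact fun x y z => add_assoc x y z
  · exact fun x => mul_one x
  · exact fun x y => mul_comm x y
  · exact fun x y z => mul_assoc x y z
  · exact fun x y z => mul_add x y z
  · exact fun x y => le_total (x : FracPoly) y
  · exact fun x y z h => le_trans (a := (x : FracPoly)) h.1 h.2
  · exact fun x h => absurd (lt_add_one (x : FracPoly)) (not_lt.2 h)
  · intro x y h
    rcases eq_or_lt_of_le (show (y : FracPoly) ≤ x from h) with h | h
    · exact Or.inl (Subtype.ext h)
    · exact Or.inr (Shepherdson.add_one_le h)
  · exact fun x y z h => add_le_add_left (show (y : FracPoly) ≤ x from h) (z : FracPoly)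
  · exact fun x y z h => mul_le_mul_of_nonneg_right (show (y : FracPoly) ≤ x from h) z.nonneg

theorem models_subtraction : Shepherdson ⊨ subtraction := by
  simp only [subtraction, Sentence.Realize, Formula.Realize, BoundedFormula.realize_all,
    BoundedFormula.realize_imp, BoundedFormula.realize_ex, BoundedFormula.realize_bdEqual,
    realize_le, realize_add]
  intro x y h
  refine ⟨⟨_, sub_mem_shepherdson y.2 x.2 h⟩, Subtype.ext ?_⟩
  exact (add_sub_cancel (y : FracPoly) x).symm

theorem models_IOpen : Shepherdson ⊨ IOpen := by
  rw [Theory.model_iff]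
  rintro σ ((hσ | hσ) | ⟨k, φ, hφ, rfl⟩)
  · exact Theory.model_iff _ |>.1 models_PAjer σ hσ
  · rw [Set.mem_singleton_iff.1 hσ]
    exact models_subtraction
  · exact realize_induction hφ

/-! ### Powers of two in Shepherdson's model -/

theorem Shepherdson.coe_natCast (n : ℕ) : ((n : Shepherdson) : FracPoly) = n :=
  map_natCast shepherdson.subtype n

theorem Shepherdson.coe_two : ((2 : Shepherdson) : FracPoly) = 2 :=
  map_ofNat shepherdson.subtype 2

theorem Shepherdson.coe_three : ((3 : Shepherdson) : FracPoly) = 3 :=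
  map_ofNat shepherdson.subtype 3

/-- Division of a formal sum by a positive integer. -/
theorem exists_natCast_mul_eq (n : ℕ) (hn : 0 < n) (f : FracPoly) :
    ∃ g : FracPoly, (n : FracPoly) * g = f ∧ ∀ t, (n : RealAlg) * g.coeff t = f.coeff t := by
  have hn0 : (n : RealAlg) ≠ 0 := Nat.cast_ne_zero.2 hn.ne'
  have h : ∀ t, (n : RealAlg) * ((n : RealAlg)⁻¹ • f).coeff t = f.coeff t := by
    intro t
    rw [AddMonoidAlgebra.coeff_smul_apply, smul_eq_mul, mul_inv_cancel_left₀ hn0]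
  refine ⟨(n : RealAlg)⁻¹ • f, ?_, h⟩
  rw [← AddMonoidAlgebra.coeff_inj]
  ext t
  rw [← nsmul_eq_mul, AddMonoidAlgebra.coeff_smul_apply, nsmul_eq_mul, h]

/-- Halving keeps the sign, and of the coefficients only the constant one has to stay an integer. -/
theorem exists_half {x : Shepherdson} {k : ℤ} (hk : (x : FracPoly).coeff 0 = (k : RealAlg))
    (h2 : 2 ∣ k) : 2 ∣ x := by
  obtain ⟨g, hg, hc⟩ := exists_natCast_mul_eq 2 two_pos (x : FracPoly)
  obtain ⟨l, rfl⟩ := h2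
  push_cast at hg hk hc
  have hg0 : 0 ≤ g := by
    have := x.nonneg
    linarith
  have hgl : g.coeff 0 = (l : RealAlg) := by
    have := hc 0
    rw [hk] at this
    exact mul_left_cancel₀ two_ne_zero this
  refine ⟨⟨g, mem_shepherdson.2 ⟨hg0, l, hgl⟩⟩, Subtype.ext ?_⟩
  push_cast
  exact hg.symm

theorem not_two_dvd_of_odd {x : Shepherdson} {k : ℤ}
    (hk : (x : FracPoly).coeff 0 = (k : RealAlg)) (h2 : ¬ 2 ∣ k) : ¬ 2 ∣ x := by
  rintro ⟨y, rfl⟩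
  obtain ⟨l, hl⟩ := y.exists_int
  refine h2 ⟨l, ?_⟩
  have : (((2 * y : Shepherdson) : FracPoly)).coeff 0 = 2 * (l : RealAlg) := by
    push_cast
    rw [Shepherdson.coe_two, two_mul, AddMonoidAlgebra.coeff_add, Finsupp.add_apply, hl, two_mul]
  rw [this] at hk
  exact_mod_cast hk.symm

/-- Here `x - 1` has even constant coefficient, so it is `2 b`; as `x ≠ 1`, `b` is positive, hence
at least 1. -/
theorem exists_eq_two_mul_add_three {x : Shepherdson} {k : ℤ}
    (hk : (x : FracPoly).coeff 0 = (k : RealAlg)) (h2 : ¬ 2 ∣ k) (hx : x ≠ 1) :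
    ∃ y, x = 2 * y + 3 := by
  have h0 : (0 : FracPoly) < x := by
    refine lt_of_le_of_ne x.nonneg fun h => h2 ?_
    rw [← h, AddMonoidAlgebra.coeff_zero, Finsupp.zero_apply] at hk
    have : k = 0 := by exact_mod_cast hk.symm
    rw [this]
    exact dvd_zero 2
  have h1 : (1 : FracPoly) ≤ x := one_le_of_pos h0 ⟨k, hk⟩
  obtain ⟨a, ha⟩ : ∃ a : Shepherdson, (a : FracPoly) = x - 1 :=
    ⟨⟨_, sub_mem_shepherdson (one_mem _) x.2 h1⟩, rfl⟩
  have hax : a + 1 = x := Subtype.ext (by push_cast; rw [ha]; ring)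
  have hak : (a : FracPoly).coeff 0 = ((k - 1 : ℤ) : RealAlg) := by
    rw [ha, AddMonoidAlgebra.coeff_sub, Finsupp.sub_apply, hk, coeff_zero_one]
    push_cast; rfl
  obtain ⟨b, hb⟩ := exists_half hak (by omega)
  have hb0 : (0 : FracPoly) < b := by
    refine lt_of_le_of_ne b.nonneg fun h => hx ?_
    have : b = 0 := Subtype.ext h.symm
    rw [← hax, hb, this]
    simp
  have hb1 := one_le_of_pos hb0 b.exists_int
  obtain ⟨c, hc⟩ : ∃ c : Shepherdson, (c : FracPoly) = b - 1 :=
    ⟨⟨_, sub_mem_shepherdson (one_mem _) b.2 hb1⟩, rfl⟩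
  refine ⟨c, Subtype.ext ?_⟩
  rw [← hax, hb]
  push_cast
  rw [hc, Shepherdson.coe_two, Shepherdson.coe_three]
  ring

theorem isPow2_iff_isPow2Tar (a : Shepherdson) : IsPow2 a ↔ IsPow2Tar a := by
  rw [isPow2_iff, isPow2Tar_iff]
  constructor
  · intro h y z hyz
    obtain ⟨k, hk⟩ := y.exists_int
    have hcoeff : ((2 * y + 3 : Shepherdson) : FracPoly).coeff 0 = ((2 * k + 3 : ℤ) : RealAlg) := by
      have : ((2 * y + 3 : Shepherdson) : FracPoly) = y + y + 1 + 1 + 1 := by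
        push_cast
        rw [Shepherdson.coe_two, Shepherdson.coe_three]
        ring
      rw [this]
      simp only [AddMonoidAlgebra.coeff_add, Finsupp.add_apply, hk, coeff_zero_one]
      push_cast
      ring
    rcases h (2 * y + 3) ⟨z, hyz⟩ with h1 | h1
    · have h2 := congrArg (Subtype.val) h1
      push_cast at h2
      rw [Shepherdson.coe_two, Shepherdson.coe_three] at h2
      have := y.nonneg
      linarith
    · exact not_two_dvd_of_odd hcoeff (by omega) h1
  · rintro h y ⟨z, rfl⟩
    obtain ⟨k, hk⟩ := y.exists_int
    by_cases h2 : 2 ∣ k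
    · exact Or.inr (exists_half hk h2)
    · by_cases h1 : y = 1
      · exact Or.inl h1
      · obtain ⟨w, hw⟩ := exists_eq_two_mul_add_three hk h2 h1
        exact absurd (by rw [hw]) (h w z)

/-- If the constant coefficient `k` is 0, then 3 divides `a`. Otherwise `a = |k| x` with `x` of
constant coefficient `±1`, and `x ≠ 1` because `a` is not the natural number `|k|`. -/
theorem not_isPow2Tar_of_nonstandard (a : Shepherdson) (ha : ∀ n : ℕ, a ≠ n) : ¬ IsPow2Tar a := by
  rw [isPow2Tar_iff]
  push Not
  obtain ⟨k, hk⟩ := a.exists_int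
  by_cases hk0 : k = 0
  · obtain ⟨g, hg, hc⟩ := exists_natCast_mul_eq 3 three_pos (a : FracPoly)
    push_cast at hg
    have hg0 : 0 ≤ g := by
      have := a.nonneg
      linarith
    have hg1 : g.coeff 0 = ((0 : ℤ) : RealAlg) := by
      have := hc 0
      rw [hk, hk0] at this
      push_cast at this ⊢
      exact (mul_eq_zero.1 this).resolve_left three_ne_zero
    refine ⟨0, ⟨g, mem_shepherdson.2 ⟨hg0, 0, hg1⟩⟩, Subtype.ext ?_⟩
    push_cast
    rw [← hg, Shepherdson.coe_two, Shepherdson.coe_three]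
    ring
  · have hn : 0 < k.natAbs := Int.natAbs_pos.2 hk0
    obtain ⟨g, hg, hc⟩ := exists_natCast_mul_eq k.natAbs hn (a : FracPoly)
    have hnR : (k.natAbs : RealAlg) ≠ 0 := Nat.cast_ne_zero.2 hn.ne'
    have hg0 : 0 ≤ g := by
      by_contra h
      have h1 : (0 : FracPoly) < k.natAbs := by exact_mod_cast hn
      have := mul_neg_of_pos_of_neg h1 (not_le.1 h)
      rw [hg] at this
      exact absurd a.nonneg (not_le.2 this)
    have hg1 : g.coeff 0 = (k.sign : RealAlg) := by
      have h1 := hc 0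
      rw [hk] at h1
      refine mul_left_cancel₀ hnR (h1.trans ?_)
      have h2 : (k : ℤ) = (k.natAbs : ℤ) * k.sign := by
        rw [mul_comm, Int.sign_mul_natAbs]
      have h3 := congrArg (Int.cast : ℤ → RealAlg) h2
      rw [h3, Int.cast_mul, Int.cast_natCast]
    obtain ⟨x, hx⟩ : ∃ x : Shepherdson, (x : FracPoly) = g :=
      ⟨⟨g, mem_shepherdson.2 ⟨hg0, _, hg1⟩⟩, rfl⟩
    have hax : a = x * (k.natAbs : Shepherdson) := by
      refine Subtype.ext ?_
      push_cast
      rw [hx, ← hg, mul_comm, Shepherdson.coe_natCast]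
    have hodd : ¬ 2 ∣ k.sign := by
      rcases lt_or_gt_of_ne hk0 with h | h
      · rw [Int.sign_eq_neg_one_of_neg h]; omega
      · rw [Int.sign_eq_one_of_pos h]; omega
    obtain ⟨y, hy⟩ := exists_eq_two_mul_add_three (x := x) (by rw [hx]; exact hg1) hodd (by
      rintro rfl
      exact ha k.natAbs (by rw [hax, one_mul]))
    exact ⟨y, _, by rw [hax, hy]⟩

theorem not_models_powersExistence : ¬ Shepherdson ⊨ powersExistence := by
  simp only [powersExistence, Sentence.Realize, Formula.Realize, BoundedFormula.realize_all,
    BoundedFormula.realize_ex, BoundedFormula.realize_inf, realize_lt, realize_le, realize_pow2,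
    realize_add, realize_mul, realize_two, realize_one]
  intro h
  -- The counterexample is `X`: a power of two above `(X + 1) / 2` would be nonstandard.
  obtain ⟨b, hb⟩ : ∃ b : FracPoly, b = AddMonoidAlgebra.single 1 1 := ⟨_, rfl⟩
  have hbB : Bdd 1 b := by
    have := bdd_single 1 1
    rwa [NNRat.cast_one, ← hb] at this
  have hbl : ld 1 b = 1 := by
    have := ld_single 1 1
    rwa [NNRat.cast_one, ← hb] at this
  have hb0 : 0 ≤ b := (pos_of_ld hbB (by rw [hbl]; exact one_pos)).le
  obtain ⟨y, hy, -, hlt⟩ := h ⟨b, mem_shepherdson.2 ⟨hb0, 0, by simp [hb]⟩⟩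
  have hy' : IsPow2 y := (isPow2_iff y).2 hy
  by_cases hn : ∃ n : ℕ, y = n
  · obtain ⟨n, rfl⟩ := hn
    have hlt' : b + 1 < (2 * n : ℕ) := by
      push_cast
      exact hlt
    have hN : Bdd 0 ((2 * n : ℕ) : FracPoly) := by
      have := bdd_one.natCast_mul (2 * n)
      rwa [mul_one] at this
    have := ld_le_ld (s := 1) (hbB.add (bdd_one.mono zero_le_one)) (hN.mono zero_le_one) hlt'.le
    rw [ld_add, hbl, bdd_one.ld_eq_zero one_pos, hN.ld_eq_zero one_pos] at this
    linarith
  · push Not at hn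
    exact not_isPow2Tar_of_nonstandard y hn ((isPow2_iff_isPow2Tar y).1 hy')

theorem not_IOpen_models_powersExistence : ¬ (IOpen ⊨ᵇ powersExistence) := by
  intro h
  have := models_IOpen
  exact not_models_powersExistence
    (Theory.models_sentence_iff.1 h (Theory.ModelType.of IOpen Shepherdson))

end Arith

theorem mainTheorem11 :
    (Arith.Shepherdson ⊨ Arith.IOpen) ∧
    (∀ α : Arith.Shepherdson, Arith.IsPow2 α ↔ Arith.IsPow2Tar α) ∧
    (∀ α : Arith.Shepherdson, (∀ n : ℕ, α ≠ (n : Arith.Shepherdson)) →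
      ¬ Arith.IsPow2 α ∧ ¬ Arith.IsPow2Tar α) ∧
    ¬ (Arith.IOpen ⊨ᵇ Arith.powersExistence) ∧
    ¬ Arith.IsSubtheory Arith.PAsmu Arith.IOpen := by
  refine ⟨Arith.models_IOpen, Arith.isPow2_iff_isPow2Tar, fun α hα => ?_,
    Arith.not_IOpen_models_powersExistence, fun h => Arith.not_IOpen_models_powersExistence
      (h _ (Theory.models_sentence_of_mem (Or.inr (Or.inl rfl))))⟩
  have := Arith.not_isPow2Tar_of_nonstandard α hα
  exact ⟨fun h => this ((Arith.isPow2_iff_isPow2Tar α).1 h), this⟩
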